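/- For every $d\ge 1$ let $p_d$ be a monic real polynomial of degree $d$ with only real roots $\lambda_1(p_d),\dots,\lambda_d(p_d)$ (with multiplicity), and put $m_n(p_d)=\frac1d\sum_{i=1}^d\lambda_i(p_d)^n$. Write $p_d(x)=\sum_{k=0}^d x^{d-k}(-1)^k\binom dk a_k(p_d)$. The finite free cumulants of $p_d$ are, for $1\le n\le d$, $$\kappa_n(p_d)=\frac{(-d)^{n-1}}{(n-1)!}\sum_{\pi\in P(n)}(-1)^{|\pi|-1}(|\pi|-1)!\prod_{V\in\pi}a_{|V|}(p_d),$$ where $P(n)$ is the set of all set partitions of $[n]=\{1,\dots,n\}$ and $|\pi|$ is the number of blocks of $\pi$. Let $\mu$ be a probability measure on $\mathbb R$ with finite moments $m_n(\mu)$ of all orders, and let its free cumulants $(r_n(\mu))_{n\ge1}$ be defined recursively by $m_n(\mu)=\sum_{\pi\in NC(n)}\prod_{V\in\pi}r_{|V|}(\mu)$ for $n\ge1$, where $NC(n)$ is the set of non-crossing partitions of $[n]$. For $V\in\pi$ put $r_{\pi\setminus V}(\mu)=\prod_{W\in\pi,\,W\ne V}r_{|W|}(\mu)$. For $t,s\ge1$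 let $\gamma_{t,s}=(1,\dots,t)(t+1,\dots,t+s)\in S_{t+s}$ and let $S_{NC}(t,s)$ be the set of $\sigma\in S_{t+s}$ such that $\langle\sigma,\gamma_{t,s}\rangle$ acts transitively on $[t+s]$ and $|\sigma|+|\sigma^{-1}\gamma_{t,s}|=t+s$, where $|\cdot|$ is the number of cycles of a permutation (fixed points included). Put $r_\sigma(\mu)=\prod_{c}r_{|c|}(\mu)$, the product over all cycles $c$ of $\sigma$, where $|c|$ is the length of $c$. **Lemma.** Suppose that $\mathfrak p=(p_d)_{d\ge1}$ has limiting distribution $\mu$, that is, $m_n(p_d)\to m_n(\mu)$ as $d\to\infty$ for every $n\ge0$. Then the following are equivalent (all $o(1/d)$ are for $d\to\infty$ with $n$ fixed): 1. $\mathfrak p$ has infinitesimal moments of all orders: there is a real sequence $(m'_n)_{n\ge1}$, not depending on $d$, with $m_n(p_d)=m_n(\mu)+\frac1d m'_n+o(1/d)$ for every $n\ge1$. 2. There is a real sequence $(\widehat r_n)_{n\ge1}$, not depending on $d$, with $\kappa_n(p_d)=r_n(\mu)+\frac1d\widehat r_n+o(1/d)$ for every $n\ge1$ (where $d\ge n$).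 Moreover, the sequences in (1) and (2) determine each other through the relation $$m'_n=\sum_{\pi\in NC(n)}\sum_{V\in\pi}\widehat r_{|V|}\,r_{\pi\setminus V}(\mu)-\frac n2\sum_{\substack{t+s=n\\ t,s\ge1}}\ \sum_{\sigma\in S_{NC}(t,s)}\frac{r_\sigma(\mu)}{ts}\qquad\text{for all }n\ge1.\tag{$*$}$$ That is: if $(m'_n)$ is as in (1) and $(\widehat r_n)$ is as in (2), then $(*)$ holds; and if two real sequences $(m'_n)_{n\ge1}$, $(\widehat r_n)_{n\ge1}$ satisfy $(*)$, then $(m'_n)$ satisfies (1) if and only if $(\widehat r_n)$ satisfies (2). -/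

import Mathlib

open Filter Topology Asymptotics MeasureTheory

namespace FiniteFree

noncomputable section

/-! ### Set partitions and annular permutations -/

/-- Set partitions of an `n`-element linearly ordered set, `P(n)`. -/
abbrev SetPartition (n : ℕ) : Type := Finpartition (Finset.univ : Finset (Fin n))

/-- A set partition is non-crossing if `a < b < c < e` with `a, c` in one block and
`b, e` in one block forces the two blocks to coincide. -/
def IsNonCrossing {n : ℕ} (π : SetPartition n) : Prop :=
  ∀ V ∈ π.parts, ∀ W ∈ π.parts, ∀ a b c e : Fin n, a < b → b < c → c < e →
    a ∈ V → c ∈ V → b ∈ W → e ∈ W → V = W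

open Classical in
/-- The finite set `NC(n)` of non-crossing partitions. -/
def NC (n : ℕ) : Finset (SetPartition n) :=
  Finset.univ.filter IsNonCrossing

/-- `γ_{t,s} = (1, 2, …, t)(t + 1, …, t + s)`, as a permutation of `Fin (t + s)`: the cyclic
rotation on the first `t` and on the last `s` points. -/
def annularRotation (t s : ℕ) : Equiv.Perm (Fin (t + s)) :=
  finSumFinEquiv.permCongr (Equiv.Perm.sumCongr (finRotate t) (finRotate s))

/-- The number of cycles of a permutation, fixed points included. -/
def numCycles {n : ℕ} (σ : Equiv.Perm (Fin n)) : ℕ := σ.partition.parts.card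

/-- The annular non-crossing permutations: `⟨σ, γ_{t,s}⟩` acts transitively and
`|σ| + |σ⁻¹ γ_{t,s}| = t + s`, where `|·|` counts cycles. -/
def IsAnnularNonCrossing (t s : ℕ) (σ : Equiv.Perm (Fin (t + s))) : Prop :=
  MulAction.IsPretransitive (Subgroup.closure {σ, annularRotation t s}) (Fin (t + s)) ∧
    numCycles σ + numCycles (σ⁻¹ * annularRotation t s) = t + s

open Classical in
/-- The finite set `S_NC(t, s)`. -/
def annularNC (t s : ℕ) : Finset (Equiv.Perm (Fin (t + s))) :=
  Finset.univ.filter (IsAnnularNonCrossing t s)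

/-- `u_π = ∏_{V ∈ π} u_{|V|}`. -/
def blockProd (u : ℕ → ℝ) {n : ℕ} (π : SetPartition n) : ℝ :=
  ∏ V ∈ π.parts, u V.card

/-- `u_σ = ∏_{c ∈ σ} u_{|c|}`, the product over all cycles (fixed points included). -/
def cycleProd (u : ℕ → ℝ) {n : ℕ} (σ : Equiv.Perm (Fin n)) : ℝ :=
  (σ.partition.parts.map u).prod

/-! ### Free cumulants -/

/-- The free cumulants of a moment sequence `m`, by the recursion
`r_n = m_n - ∑_{π ∈ NC(n), π ≠ 1_n} ∏_{V ∈ π} r_{|V|}`. Every block of a partition `π ≠ 1_n` has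
fewer than `n` elements (`card_lt_of_ne_top`), so the value `0` below is never used; see
`moment_eq_sum_blockProd` for the resulting moment-cumulant formula. -/
def freeCumulantSeq (m : ℕ → ℝ) (n : ℕ) : ℝ :=
  m n - ∑ π ∈ (NC n).erase ⊤, ∏ V ∈ π.parts,
    if _h : V.card < n then freeCumulantSeq m V.card else 0
termination_by n

theorem card_lt_of_ne_top {n : ℕ} {π : SetPartition n} (hπ : π ≠ ⊤) {V : Finset (Fin n)}
    (hV : V ∈ π.parts) : V.card < n := by
  rcases lt_or_eq_of_le (by simpa using Finset.card_le_univ V) with h | h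
  · exact h
  · exfalso
    have hVu : V = Finset.univ := (Finset.card_eq_iff_eq_univ V).1 (by simpa using h)
    apply hπ
    refine le_antisymm le_top fun b hb => ⟨V, hV, ?_⟩
    rw [hVu]
    exact Finset.subset_univ b

theorem top_mem_NC {n : ℕ} : (⊤ : SetPartition n) ∈ NC n := by
  classical
  simp only [NC, Finset.mem_filter, Finset.mem_univ, true_and]
  intro V hV W hW _ _ _ _ _ _ _ _ _ _ _
  exact Finpartition.parts_top_subsingleton _ hV hW

/-- The moment-cumulant formula, which determines the free cumulants. -/
theorem moment_eq_sum_blockProd (m : ℕ → ℝ) {n : ℕ} (hn : 1 ≤ n) :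
    m n = ∑ π ∈ NC n, blockProd (freeCumulantSeq m) π := by
  classical
  have hne : (Finset.univ : Finset (Fin n)) ≠ ⊥ := by
    have : Nonempty (Fin n) := ⟨⟨0, hn⟩⟩
    exact Finset.univ_nonempty.ne_empty
  have htop : blockProd (freeCumulantSeq m) (⊤ : SetPartition n) = freeCumulantSeq m n := by
    have : (⊤ : SetPartition n).parts = {Finset.univ} := by
      apply (Finset.Nonempty.subset_singleton_iff
        (Finpartition.parts_nonempty _ hne)).1 (Finpartition.parts_top_subset _)
    simp [blockProd, this]
  rw [← Finset.add_sum_erase _ _ top_mem_NC, htop, freeCumulantSeq]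
  have : ∀ π ∈ (NC n).erase ⊤, (∏ V ∈ π.parts,
      if _h : V.card < n then freeCumulantSeq m V.card else 0)
      = blockProd (freeCumulantSeq m) π := by
    intro π hπ
    refine Finset.prod_congr rfl fun V hV => ?_
    rw [dif_pos (card_lt_of_ne_top (Finset.ne_of_mem_erase hπ) hV)]
  rw [Finset.sum_congr rfl this]
  ring

/-- The moment `m_n(μ) = ∫ xⁿ dμ`. -/
def moment (μ : Measure ℝ) (n : ℕ) : ℝ := ∫ x, x ^ n ∂μ

/-- The free cumulant `r_n(μ)`. -/
def freeCumulant (μ : Measure ℝ) (n : ℕ) : ℝ := freeCumulantSeq (moment μ) n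

/-! ### Polynomials -/

/-- Monic real polynomials of degree `d` all of whose roots are real. -/
def IsMonicRealRooted (d : ℕ) (p : Polynomial ℝ) : Prop :=
  p.Monic ∧ p.natDegree = d ∧ p.Splits

/-- The `n`-th moment of the root distribution, `(1/d) ∑ λ_iⁿ` over the roots counted with
multiplicity. -/
def rootMoment (p : Polynomial ℝ) (n : ℕ) : ℝ :=
  (1 / (p.natDegree : ℝ)) * (p.roots.map fun x => x ^ n).sum

/-- The normalized coefficients `a_k`, given for `0 ≤ k ≤ d = deg p` by
`p = ∑_{k ≤ d} x^{d-k} (-1)^k (d choose k) a_k`. -/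
def normCoeff (p : Polynomial ℝ) (k : ℕ) : ℝ :=
  (-1) ^ k * p.coeff (p.natDegree - k) / (p.natDegree.choose k : ℝ)

theorem eq_sum_normCoeff (p : Polynomial ℝ) :
    p = ∑ k ∈ Finset.range (p.natDegree + 1), Polynomial.X ^ (p.natDegree - k) *
      Polynomial.C ((-1) ^ k * (p.natDegree.choose k : ℝ) * normCoeff p k) := by
  conv_lhs => rw [p.as_sum_range_C_mul_X_pow, ← Finset.sum_range_reflect]
  refine Finset.sum_congr rfl fun k hk => ?_
  have hk' : k ≤ p.natDegree := Nat.lt_succ_iff.1 (Finset.mem_range.1 hk)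
  have h0 : (p.natDegree.choose k : ℝ) ≠ 0 := by
    exact_mod_cast (Nat.choose_pos hk').ne'
  have h1 : ((-1 : ℝ) ^ k) * (-1) ^ k = 1 := by rw [← mul_pow]; simp
  have h2 : (-1) ^ k * (p.natDegree.choose k : ℝ) * normCoeff p k
      = p.coeff (p.natDegree - k) := by
    unfold normCoeff
    field_simp
    linear_combination p.coeff (p.natDegree - k) * h1
  rw [h2, show p.natDegree + 1 - 1 - k = p.natDegree - k by omega, mul_comm]

/-- The finite free cumulants (meaningful for `1 ≤ n ≤ d = deg p`)
`κ_n(p) = (-d)^{n-1}/(n-1)! ∑_{π ∈ P(n)} (-1)^{|π|-1} (|π|-1)! ∏_{V ∈ π} a_{|V|}`. -/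
def finiteFreeCumulant (p : Polynomial ℝ) (n : ℕ) : ℝ :=
  (-(p.natDegree : ℝ)) ^ (n - 1) / ((n - 1).factorial : ℝ) *
    ∑ π : SetPartition n, (-1) ^ (π.parts.card - 1) * ((π.parts.card - 1).factorial : ℝ) *
      blockProd (normCoeff p) π

/-! ### Asymptotic expansions along a sequence of polynomials -/

/-- The sequence `p` converges in moments to `μ`, which has finite moments of all orders. -/
def HasLimitingDistribution (p : ℕ → Polynomial ℝ) (μ : Measure ℝ) : Prop :=
  (∀ n : ℕ, Integrable (fun x : ℝ => x ^ n) μ) ∧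
    ∀ n : ℕ, Tendsto (fun d => rootMoment (p d) n) atTop (𝓝 (moment μ n))

/-- `m_n(p_d) = m_n(μ) + m'_n / d + o(1/d)` as `d → ∞`, for all `n ≥ 1`. -/
def HasInfinitesimalMoments (p : ℕ → Polynomial ℝ) (μ : Measure ℝ) (m' : ℕ → ℝ) : Prop :=
  ∀ n : ℕ, 1 ≤ n →
    (fun d : ℕ => rootMoment (p d) n - (moment μ n + 1 / (d : ℝ) * m' n))
      =o[atTop] (fun d : ℕ => 1 / (d : ℝ))

/-- `κ_n(p_d) = r_n(μ) + r̂_n / d + o(1/d)` as `d → ∞` (`d ≥ n`), for all `n ≥ 1`. -/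
def HasCumulantFluctuations (p : ℕ → Polynomial ℝ) (μ : Measure ℝ) (rhat : ℕ → ℝ) : Prop :=
  ∀ n : ℕ, 1 ≤ n →
    (fun d : ℕ => finiteFreeCumulant (p d) n - (freeCumulant μ n + 1 / (d : ℝ) * rhat n))
      =o[atTop] (fun d : ℕ => 1 / (d : ℝ))

/-- The right-hand side
`∑_{π ∈ NC(n)} ∑_{V ∈ π} r̂_{|V|} ∏_{W ∈ π, W ≠ V} r_{|W|}
  - (n/2) ∑_{t + s = n, t, s ≥ 1} ∑_{σ ∈ S_NC(t,s)} r_σ / (t s)`. -/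
def infinitesimalMomentFormula (r rhat : ℕ → ℝ) (n : ℕ) : ℝ :=
  (∑ π ∈ NC n, ∑ V ∈ π.parts, (rhat V.card * ∏ W ∈ π.parts.erase V, r W.card))
    - (n : ℝ) / 2 *
      ∑ ts ∈ (Finset.HasAntidiagonal.antidiagonal n).filter (fun ts => 1 ≤ ts.1 ∧ 1 ≤ ts.2),
        ∑ σ ∈ annularNC ts.1 ts.2, cycleProd r σ / ((ts.1 : ℝ) * (ts.2 : ℝ))

end

end FiniteFree

/-!
By the exponential formula for pairs of permutations and Newton's identities, the moment of order
`n` of a real-rooted polynomial of degree `d` is a genus expansion in its finite free cumulants: it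
is `1 / (n - 1)!` times the sum of `κ_σ (-1 / d) ^ (n + 1 - |σ| - |τ|)` over the pairs `(σ, τ)` in
`S_n` that generate a transitive group. The exponent is nonnegative because a function that is
invariant under both `σ` and `τ` is constant, and comparing dimensions of invariant functions also
bounds the number of cycles of `σ τ`. If the exponent is `0`, then `σ τ` is one of the `(n - 1)!`
full cycles and `σ` is a non-crossing partition drawn on it. If the exponent is `1`, then `σ τ` has
two cycles, of lengths `t` and `s`, and `σ` is an annular non-crossing permutation; counting the
permutations with cycle lengths `t` and `s` produces the factor `n / (2 t s)`.

Thus the leading term of the expansion is the free moment-cumulant formula and the coefficient of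
`1 / d` is the right-hand side of the relation to be proved. In the opposite direction, `κ_n` enters
the moment of order `n` linearly, with a coefficient that tends to `1`, and the other terms involve
only `κ_1, …, κ_{n-1}`, so expansions of the cumulants are recovered from those of the moments one
order at a time.
-/

namespace FiniteFree

noncomputable section

open Equiv Finset

/-! ### Cycles of permutations -/

section Cycles

variable {α β : Type*} [Fintype α] [DecidableEq α] [Fintype β] [DecidableEq β]

open Classical in
/-- The partition of the ground set into the cycles of a permutation, fixed points included. -/
def cyclePartition (σ : Perm α) : Finpartition (univ : Finset α) :=
  Finpartition.ofSetoid (Perm.SameCycle.setoid σ)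

/-- The number of cycles of a permutation of any finite type, fixed points included; on `Fin n`
it is `numCycles` by definition. -/
def cycleCount (σ : Perm α) : ℕ := σ.partition.parts.card

/-- The product of `u |c|` over the cycles `c` of a permutation of any finite type, fixed points
included; on `Fin n` and for real weights it is `cycleProd` by definition. -/
def cycleWeight {M : Type*} [CommMonoid M] (u : ℕ → M) (σ : Perm α) : M :=
  (σ.partition.parts.map u).prod

theorem mem_part_cyclePartition {σ : Perm α} {a b : α} :
    b ∈ (cyclePartition σ).part a ↔ σ.SameCycle a b := by
  classical
  exact Finpartition.mem_part_ofSetoid_iff_rel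

theorem mem_parts_cyclePartition {σ : Perm α} {V : Finset α} :
    V ∈ (cyclePartition σ).parts ↔ ∃ a, V = univ.filter (σ.SameCycle a) := by
  have part_eq (a : α) : (cyclePartition σ).part a = univ.filter (σ.SameCycle a) := by
    ext b
    rw [mem_part_cyclePartition, mem_filter_univ]
  simp only [← part_eq]
  constructor
  · intro hV
    obtain ⟨a, -, rfl⟩ := (cyclePartition σ).part_surjOn hV
    exact ⟨a, rfl⟩
  · rintro ⟨a, rfl⟩
    exact Finpartition.part_mem _ |>.2 (mem_univ a)

theorem filter_sameCycle_of_apply_eq_self {σ : Perm α} {a : α} (ha : σ a = a) :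
    univ.filter (σ.SameCycle a) = {a} := by
  ext b
  rw [mem_filter_univ, mem_singleton]
  exact ⟨fun h => (h.eq_of_left ha).symm, fun h => h ▸ Perm.SameCycle.refl σ b⟩

theorem filter_sameCycle_of_apply_ne_self {σ : Perm α} {a : α} (ha : σ a ≠ a) :
    univ.filter (σ.SameCycle a) = (σ.cycleOf a).support := by
  ext b
  rw [mem_filter_univ, Perm.mem_support_cycleOf_iff]
  exact ⟨fun h => ⟨h, Perm.mem_support.2 ha⟩, And.left⟩

theorem parts_cyclePartition (σ : Perm α) :
    (cyclePartition σ).parts =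
      σ.cycleFactorsFinset.image Perm.support ∪ (univ \ σ.support).image singleton := by
  ext V
  simp only [mem_parts_cyclePartition, mem_union, mem_image, Finset.mem_sdiff, mem_univ, true_and,
    Perm.mem_support, not_not]
  constructor
  · rintro ⟨a, rfl⟩
    by_cases ha : σ a = a
    · exact Or.inr ⟨a, ha, (filter_sameCycle_of_apply_eq_self ha).symm⟩
    · exact Or.inl ⟨σ.cycleOf a, Perm.cycleOf_mem_cycleFactorsFinset_iff.2 (Perm.mem_support.2 ha),
        (filter_sameCycle_of_apply_ne_self ha).symm⟩
  · rintro (⟨c, hc, rfl⟩ | ⟨a, ha, rfl⟩)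
    · obtain ⟨a, ha⟩ := (Perm.mem_cycleFactorsFinset_iff.1 hc).1.nonempty_support
      have hσa : σ a ≠ a := Perm.mem_support.1 (Perm.mem_cycleFactorsFinset_support_le hc ha)
      exact ⟨a, by rw [filter_sameCycle_of_apply_ne_self hσa, ← Perm.cycle_is_cycleOf ha hc]⟩
    · exact ⟨a, (filter_sameCycle_of_apply_eq_self ha).symm⟩

theorem injOn_support_cycleFactorsFinset (σ : Perm α) :
    Set.InjOn Perm.support (σ.cycleFactorsFinset : Set (Perm α)) := by
  intro c hc c' hc' h
  obtain ⟨a, ha⟩ := (Perm.mem_cycleFactorsFinset_iff.1 hc).1.nonempty_support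
  rw [Perm.cycle_is_cycleOf ha hc, Perm.cycle_is_cycleOf (h ▸ ha) hc']

theorem partition_parts_eq_map_card (σ : Perm α) :
    σ.partition.parts = (cyclePartition σ).parts.val.map Finset.card := by
  have hdisj : Disjoint (σ.cycleFactorsFinset.image Perm.support)
      ((univ \ σ.support).image (singleton : α → Finset α)) := by
    simp only [Finset.disjoint_left, mem_image, Finset.mem_sdiff, mem_univ, true_and]
    rintro _ ⟨c, hc, rfl⟩ ⟨a, ha, hac⟩
    exact ha (Perm.mem_cycleFactorsFinset_support_le hc (hac ▸ mem_singleton_self a))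
  rw [parts_cyclePartition, ← Finset.disjUnion_eq_union _ _ hdisj, Finset.disjUnion_val,
    Multiset.map_add, Finset.image_val_of_injOn (injOn_support_cycleFactorsFinset σ),
    Finset.image_val_of_injOn Finset.singleton_injective.injOn, Multiset.map_map,
    Multiset.map_map, Perm.parts_partition, Perm.cycleType_def]
  congr 1
  simp only [Function.comp_def, card_singleton, Multiset.map_const', card_val,
    card_sdiff_of_subset (subset_univ _), card_univ]

theorem cycleWeight_eq_prod {M : Type*} [CommMonoid M] (u : ℕ → M) (σ : Perm α) :
    cycleWeight u σ = ∏ V ∈ (cyclePartition σ).parts, u V.card := by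
  rw [cycleWeight, partition_parts_eq_map_card, Multiset.map_map]
  rfl

theorem cycleCount_eq_card_parts (σ : Perm α) :
    cycleCount σ = (cyclePartition σ).parts.card := by
  rw [cycleCount, partition_parts_eq_map_card, Multiset.card_map, Finset.card_val]

theorem cycleCount_pos [Nonempty α] (σ : Perm α) : 0 < cycleCount σ := by
  rw [cycleCount_eq_card_parts]
  exact Finset.card_pos.2 (Finpartition.parts_nonempty _ Finset.univ_nonempty.ne_empty)

theorem cycleCount_le (σ : Perm α) : cycleCount σ ≤ Fintype.card α := by
  rw [cycleCount_eq_card_parts]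
  exact Finpartition.card_parts_le_card _

theorem cycleCount_one : cycleCount (1 : Perm α) = Fintype.card α := by
  simp [cycleCount, Perm.parts_partition]

theorem cycleCount_eq_card_iff {σ : Perm α} : cycleCount σ = Fintype.card α ↔ σ = 1 := by
  refine ⟨fun h => ?_, fun h => h ▸ cycleCount_one⟩
  rw [cycleCount, Perm.parts_partition, Multiset.card_add, Multiset.card_replicate] at h
  have hsupp : σ.support.card ≤ Fintype.card α := Finset.card_le_univ _
  have htwo := Multiset.card_nsmul_le_sum (s := σ.cycleType) (a := 2)
    fun k hk => Perm.two_le_of_mem_cycleType hk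
  rw [Perm.sum_cycleType, smul_eq_mul] at htwo
  exact Perm.card_cycleType_eq_zero.1 (by omega)

theorem partition_parts_permCongr (e : α ≃ β) (σ : Perm α) :
    (e.permCongr σ).partition.parts = σ.partition.parts := by
  let f : α ≃ Subtype (fun _ : β => True) := e.trans (Equiv.subtypeUnivEquiv fun _ => trivial).symm
  have h : e.permCongr σ = σ.extendDomain f := by
    ext b
    obtain ⟨a, rfl⟩ := e.surjective b
    have : e a = (f a : β) := rfl
    rw [this, Perm.extendDomain_apply_image, ← this, Equiv.permCongr_apply, e.symm_apply_apply]
    rfl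
  rw [Perm.parts_partition, Perm.parts_partition, h, Perm.cycleType_extendDomain,
    Perm.card_support_extend_domain, Fintype.card_congr e]

theorem cycleWeight_permCongr {M : Type*} [CommMonoid M] (u : ℕ → M) (e : α ≃ β) (σ : Perm α) :
    cycleWeight u (e.permCongr σ) = cycleWeight u σ := by
  rw [cycleWeight, cycleWeight, partition_parts_permCongr]

theorem cycleCount_permCongr (e : α ≃ β) (σ : Perm α) :
    cycleCount (e.permCongr σ) = cycleCount σ := by
  rw [cycleCount, cycleCount, partition_parts_permCongr]

theorem subtypeCongr_eq_ofSubtype_mul_ofSubtype {α : Type*} {p : α → Prop} [DecidablePred p]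
    (σ : Perm {a // p a}) (τ : Perm {a // ¬p a}) :
    Perm.subtypeCongr σ τ = Perm.ofSubtype σ * Perm.ofSubtype τ := by
  ext a
  by_cases ha : p a
  · rw [Perm.subtypeCongr.left_apply _ _ ha, Perm.mul_apply,
      Perm.ofSubtype_apply_of_not_mem τ (not_not.2 ha), Perm.ofSubtype_apply_of_mem σ ha]
  · rw [Perm.subtypeCongr.right_apply _ _ ha, Perm.mul_apply, Perm.ofSubtype_apply_of_mem τ ha,
      Perm.ofSubtype_apply_of_not_mem σ (τ ⟨a, ha⟩).2]

theorem disjoint_ofSubtype_ofSubtype_not {α : Type*} {p : α → Prop} [DecidablePred p]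
    (σ : Perm {a // p a}) (τ : Perm {a // ¬p a}) :
    Perm.Disjoint (Perm.ofSubtype σ) (Perm.ofSubtype τ) := by
  intro a
  by_cases ha : p a
  · exact Or.inr (Perm.ofSubtype_apply_of_not_mem τ (not_not.2 ha))
  · exact Or.inl (Perm.ofSubtype_apply_of_not_mem σ ha)

theorem partition_parts_subtypeCongr (p : α → Prop) [DecidablePred p]
    [Fintype {a // p a}] [Fintype {a // ¬p a}] (σ : Perm {a // p a}) (τ : Perm {a // ¬p a}) :
    (Perm.subtypeCongr σ τ).partition.parts = σ.partition.parts + τ.partition.parts := by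
  have hcard : Fintype.card α = Fintype.card {a // p a} + Fintype.card {a // ¬p a} := by
    rw [Fintype.card_subtype_compl, Nat.add_sub_cancel' (Fintype.card_subtype_le p)]
  have hσ : σ.support.card ≤ Fintype.card {a // p a} := Finset.card_le_univ _
  have hτ : τ.support.card ≤ Fintype.card {a // ¬p a} := Finset.card_le_univ _
  have hdisj := disjoint_ofSubtype_ofSubtype_not σ τ
  simp only [Perm.parts_partition, subtypeCongr_eq_ofSubtype_mul_ofSubtype, hdisj.cycleType_mul,
    hdisj.card_support_mul, ← Perm.sum_cycleType, Perm.cycleType_ofSubtype]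
  simp only [Perm.sum_cycleType, hcard, ← tsub_add_tsub_comm hσ hτ, Multiset.replicate_add]
  abel

theorem cycleWeight_subtypeCongr {M : Type*} [CommMonoid M] (u : ℕ → M) (p : α → Prop)
    [DecidablePred p] [Fintype {a // p a}] [Fintype {a // ¬p a}]
    (σ : Perm {a // p a}) (τ : Perm {a // ¬p a}) :
    cycleWeight u (Perm.subtypeCongr σ τ) = cycleWeight u σ * cycleWeight u τ := by
  rw [cycleWeight, partition_parts_subtypeCongr, Multiset.map_add, Multiset.prod_add]
  rfl

theorem sign_eq_neg_one_pow (σ : Perm α) :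
    (Perm.sign σ : ℤ) = (-1) ^ (Fintype.card α + cycleCount σ) := by
  obtain ⟨k, hk⟩ := Nat.exists_eq_add_of_le (Finset.card_le_univ σ.support)
  rw [Perm.sign_of_cycleType, Perm.sum_cycleType, cycleCount, Perm.parts_partition,
    Multiset.card_add, Multiset.card_replicate, hk, Nat.add_sub_cancel_left,
    show σ.support.card + k + (Multiset.card σ.cycleType + k) =
      σ.support.card + Multiset.card σ.cycleType + 2 * k by ring, pow_add _ _ (2 * k)]
  simp

theorem even_card_add_cycleCount (σ τ : Perm α) :
    Even (Fintype.card α + cycleCount σ + cycleCount τ + cycleCount (σ * τ)) := by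
  have h : (Perm.sign (σ * τ) : ℤ) = Perm.sign σ * Perm.sign τ := by
    rw [Perm.sign_mul, Units.val_mul]
  rw [sign_eq_neg_one_pow, sign_eq_neg_one_pow, sign_eq_neg_one_pow, ← pow_add] at h
  have hone : (-1 : ℤ) ^ (Fintype.card α + cycleCount (σ * τ) +
      (Fintype.card α + cycleCount σ + (Fintype.card α + cycleCount τ))) = 1 := by
    rw [pow_add, h, ← pow_add]
    exact Even.neg_one_pow ⟨_, rfl⟩
  rw [neg_one_pow_eq_one_iff_even (by decide), Nat.even_iff] at hone
  rw [Nat.even_iff]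
  omega

end Cycles

/-! ### The genus inequality -/

section Genus

variable {α : Type*}

/-- The functions that are constant on the cycles of a permutation. -/
def invariantFunctions (σ : Perm α) : Submodule ℝ (α → ℝ) where
  carrier := {f | ∀ a, f (σ a) = f a}
  add_mem' hf hg a := by rw [Pi.add_apply, Pi.add_apply, hf a, hg a]
  zero_mem' a := rfl
  smul_mem' c f hf a := by rw [Pi.smul_apply, Pi.smul_apply, hf a]

theorem eq_of_sameCycle [Finite α] {σ : Perm α} {f : α → ℝ} (hf : f ∈ invariantFunctions σ)
    {a b : α} (h : σ.SameCycle a b) : f a = f b := by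
  obtain ⟨k, -, rfl⟩ := h.exists_pow_eq'
  induction k with
  | zero => rfl
  | succ k ih =>
    rw [ih (Perm.sameCycle_pow_right.2 (Perm.SameCycle.refl _ _)), pow_succ', Perm.mul_apply, hf]

/-- The group generated by two permutations acts transitively. -/
abbrev JointlyTransitive (σ τ : Perm α) : Prop :=
  MulAction.IsPretransitive (Subgroup.closure {σ, τ}) α

theorem JointlyTransitive.eq_of_invariant {σ τ : Perm α} (h : JointlyTransitive σ τ)
    {f : α → ℝ} (hσ : f ∈ invariantFunctions σ) (hτ : f ∈ invariantFunctions τ) (a b : α) :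
    f a = f b := by
  obtain ⟨⟨g, hg⟩, rfl⟩ := h.exists_smul_eq a b
  change f a = f (g a)
  induction hg using Subgroup.closure_induction generalizing a with
  | mem x hx =>
    rcases hx with rfl | rfl
    · exact (hσ a).symm
    · exact (hτ a).symm
  | one => rfl
  | mul x y _ _ hx hy => rw [Perm.mul_apply, ← hx, ← hy]
  | inv x _ hx => rw [hx (x⁻¹ a), Perm.coe_inv, Equiv.apply_symm_apply]

theorem finrank_le_one_of_constant (S : Submodule ℝ (α → ℝ)) (h : ∀ f ∈ S, ∀ a b, f a = f b) :
    Module.finrank ℝ S ≤ 1 := by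
  rcases isEmpty_or_nonempty α with hα | ⟨⟨a⟩⟩
  · have : Subsingleton S := ⟨fun x y => Subtype.ext (Subsingleton.elim _ _)⟩
    rw [Module.finrank_zero_of_subsingleton]
    exact zero_le_one
  · have hinj : Function.Injective ((LinearMap.proj a : (α → ℝ) →ₗ[ℝ] ℝ).domRestrict S) :=
      fun f g hfg => Subtype.ext (funext fun b => by rw [h f f.2 b a, h g g.2 b a]; exact hfg)
    exact (LinearMap.finrank_le_finrank_of_injective hinj).trans_eq (Module.finrank_self ℝ)

/-- The operator `l ↦ l - l ∘ τ⁻¹`, which vanishes exactly on the `τ`-invariant functions. -/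
def cycleDifference (τ : Perm α) : (α → ℝ) →ₗ[ℝ] (α → ℝ) :=
  LinearMap.id - LinearMap.funLeft ℝ ℝ (τ⁻¹ : Perm α)

theorem cycleDifference_apply (τ : Perm α) (l : α → ℝ) (a : α) :
    cycleDifference τ l a = l a - l (τ⁻¹ a) := rfl

theorem mem_invariantFunctions_of_cycleDifference_eq_zero {τ : Perm α} {l : α → ℝ}
    (h : cycleDifference τ l = 0) : l ∈ invariantFunctions τ := by
  intro a
  have hτa := congrFun h (τ a)
  rwa [cycleDifference_apply, Perm.coe_inv, Equiv.symm_apply_apply, Pi.zero_apply,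
    sub_eq_zero] at hτa

theorem sum_cycleDifference_mul [Fintype α] {σ τ : Perm α} {l : α → ℝ}
    (hl : l ∈ invariantFunctions (σ * τ)) (f : α → ℝ) :
    ∑ a, cycleDifference τ l a * f a = ∑ a, l a * (f (σ (τ a)) - f (τ a)) := by
  simp only [cycleDifference_apply, sub_mul, mul_sub, Finset.sum_sub_distrib]
  congr 1
  · rw [← Equiv.sum_comp (σ * τ)]
    exact Finset.sum_congr rfl fun a _ => by rw [hl a, Perm.mul_apply]
  · rw [← Equiv.sum_comp τ]
    exact Finset.sum_congr rfl fun a _ => by rw [Perm.coe_inv, Equiv.symm_apply_apply]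

theorem sum_cycleDifference_mul_eq_zero [Fintype α] {σ τ : Perm α} {l f : α → ℝ}
    (hl : l ∈ invariantFunctions (σ * τ)) (hf : f ∈ invariantFunctions σ ⊔ invariantFunctions τ) :
    ∑ a, cycleDifference τ l a * f a = 0 := by
  obtain ⟨g, hg, k, hk, rfl⟩ := Submodule.mem_sup.1 hf
  have hgk (a : α) : (g + k) (σ (τ a)) - (g + k) (τ a) = k ((σ * τ) a) - k a := by
    simp only [Pi.add_apply, hg (τ a), hk a, Perm.mul_apply]
    ring
  simp only [sum_cycleDifference_mul hl, hgk, mul_sub, Finset.sum_sub_distrib]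
  rw [sub_eq_zero, ← Equiv.sum_comp (σ * τ) fun a => l a * k a]
  exact Finset.sum_congr rfl fun a _ => by rw [hl a]

theorem disjoint_map_cycleDifference [Finite α] (σ τ : Perm α) :
    Disjoint ((invariantFunctions (σ * τ)).map (cycleDifference τ))
      (invariantFunctions σ ⊔ invariantFunctions τ) := by
  have := Fintype.ofFinite α
  rw [Submodule.disjoint_def]
  rintro _ ⟨l, hl, rfl⟩ hf
  have hzero := sum_cycleDifference_mul_eq_zero hl hf
  rw [Finset.sum_eq_zero_iff_of_nonneg fun a _ => mul_self_nonneg _] at hzero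
  exact funext fun a => mul_self_eq_zero.1 (hzero a (mem_univ a))

theorem finrank_invariantFunctions_mul_le [Finite α] {σ τ : Perm α} (h : JointlyTransitive σ τ) :
    Module.finrank ℝ (invariantFunctions (σ * τ)) ≤
      Module.finrank ℝ ((invariantFunctions (σ * τ)).map (cycleDifference τ)) + 1 := by
  set L := (cycleDifference τ).domRestrict (invariantFunctions (σ * τ)) with hL
  have hker : Module.finrank ℝ (LinearMap.ker L) ≤ 1 := by
    rw [← Submodule.finrank_map_subtype_eq]
    refine finrank_le_one_of_constant _ ?_
    rintro _ ⟨l, hl, rfl⟩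
    have hτ := mem_invariantFunctions_of_cycleDifference_eq_zero (LinearMap.mem_ker.1 hl)
    refine h.eq_of_invariant (fun a => ?_) hτ
    obtain ⟨b, rfl⟩ := τ.surjective a
    rw [hτ b]
    exact l.2 b
  rw [← LinearMap.range_domRestrict, ← hL, ← LinearMap.finrank_range_add_finrank_ker L]
  gcongr

variable [Fintype α] [DecidableEq α]

theorem finrank_invariantFunctions (σ : Perm α) :
    Module.finrank ℝ (invariantFunctions σ) = cycleCount σ := by
  let cycle : α → (cyclePartition σ).parts := fun a =>
    ⟨(cyclePartition σ).part a, (Finpartition.part_mem _).2 (mem_univ a)⟩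
  have hsurj : Function.Surjective cycle := by
    rintro ⟨V, hV⟩
    obtain ⟨a, -, ha⟩ := (cyclePartition σ).part_surjOn hV
    exact ⟨a, Subtype.ext ha⟩
  have hcycle (a b : α) : cycle a = cycle b ↔ σ.SameCycle a b := by
    rw [Subtype.ext_iff, ← mem_part_cyclePartition,
      Finpartition.mem_part_iff_part_eq_part _ (mem_univ b) (mem_univ a)]
    exact eq_comm
  have hrange : LinearMap.range (LinearMap.funLeft ℝ ℝ cycle) = invariantFunctions σ := by
    ext f
    rw [LinearMap.mem_range]
    constructor
    · rintro ⟨g, rfl⟩ a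
      rw [LinearMap.funLeft_apply, LinearMap.funLeft_apply,
        (hcycle _ _).2 (Perm.sameCycle_apply_left.2 (Perm.SameCycle.refl σ a))]
    · intro hf
      refine ⟨fun q => f (Function.surjInv hsurj q), funext fun a => ?_⟩
      exact eq_of_sameCycle hf ((hcycle _ _).1 (Function.surjInv_eq hsurj (cycle a)))
  rw [← hrange,
    LinearMap.finrank_range_of_inj (LinearMap.funLeft_injective_of_surjective _ _ _ hsurj),
    Module.finrank_fintype_fun_eq_card, Fintype.card_coe, cycleCount_eq_card_parts]

theorem cycleCount_add_le_finrank_sup {σ τ : Perm α} (h : JointlyTransitive σ τ) :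
    cycleCount σ + cycleCount τ ≤
      Module.finrank ℝ (invariantFunctions σ ⊔ invariantFunctions τ : Submodule ℝ (α → ℝ)) + 1 := by
  rw [← finrank_invariantFunctions, ← finrank_invariantFunctions,
    ← Submodule.finrank_sup_add_finrank_inf_eq]
  gcongr
  exact finrank_le_one_of_constant _ fun f hf => h.eq_of_invariant hf.1 hf.2

theorem cycleCount_add_add_le {σ τ : Perm α} (h : JointlyTransitive σ τ) :
    cycleCount σ + cycleCount τ + cycleCount (σ * τ) ≤ Fintype.card α + 2 := by
  have hsum := cycleCount_add_le_finrank_sup h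
  have hmul := finrank_invariantFunctions_mul_le h
  have hdim := Submodule.finrank_add_finrank_le_of_disjoint (disjoint_map_cycleDifference σ τ)
  rw [finrank_invariantFunctions] at hmul
  rw [Module.finrank_fintype_fun_eq_card] at hdim
  omega

theorem sup_invariantFunctions_eq_top {σ τ : Perm α} (h : JointlyTransitive σ τ)
    (hc : cycleCount σ + cycleCount τ = Fintype.card α + 1) :
    invariantFunctions σ ⊔ invariantFunctions τ = ⊤ := by
  refine Submodule.eq_top_of_finrank_eq (le_antisymm (Submodule.finrank_le _) ?_)
  have := cycleCount_add_le_finrank_sup h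
  rw [Module.finrank_fintype_fun_eq_card]
  omega

variable [Nonempty α]

theorem cycleCount_add_le {σ τ : Perm α} (h : JointlyTransitive σ τ) :
    cycleCount σ + cycleCount τ ≤ Fintype.card α + 1 := by
  have := cycleCount_add_add_le h
  have := cycleCount_pos (σ * τ)
  omega

theorem cycleCount_mul_eq_one {σ τ : Perm α} (h : JointlyTransitive σ τ)
    (hc : cycleCount σ + cycleCount τ = Fintype.card α + 1) : cycleCount (σ * τ) = 1 := by
  have := cycleCount_add_add_le h
  have := cycleCount_pos (σ * τ)
  omega

theorem cycleCount_mul_eq_two {σ τ : Perm α} (h : JointlyTransitive σ τ)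
    (hc : cycleCount σ + cycleCount τ = Fintype.card α) : cycleCount (σ * τ) = 2 := by
  have := cycleCount_add_add_le h
  have := cycleCount_pos (σ * τ)
  have hparity := even_card_add_cycleCount σ τ
  rw [Nat.even_iff] at hparity
  omega

end Genus

/-! ### Genus zero and non-crossing partitions -/

section NonCrossing

/-- `σ` maps every point to the cyclically next point of its block. -/
def IsCyclicSuccessor {n : ℕ} (π : SetPartition n) (σ : Perm (Fin n)) : Prop :=
  ∀ a, σ a ∈ π.part a ∧ ((a < σ a ∧ ∀ j ∈ π.part a, a < j → σ a ≤ j) ∨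
    ∀ j ∈ π.part a, σ a ≤ j ∧ j ≤ a)

section Parts

variable {α : Type*} [Fintype α] [DecidableEq α]

theorem mem_part_iff_part_eq {π : Finpartition (univ : Finset α)} {a b : α} :
    b ∈ π.part a ↔ π.part b = π.part a :=
  π.mem_part_iff_part_eq_part (mem_univ b) (mem_univ a)

theorem self_mem_part (π : Finpartition (univ : Finset α)) (a : α) : a ∈ π.part a :=
  π.mem_part_self.2 (mem_univ a)

theorem part_mem_parts (π : Finpartition (univ : Finset α)) (a : α) : π.part a ∈ π.parts :=
  π.part_mem.2 (mem_univ a)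

theorem parts_eq_image_part (π : Finpartition (univ : Finset α)) :
    π.parts = univ.image π.part := by
  ext V
  rw [mem_image]
  exact ⟨fun hV => π.part_surjOn hV, by rintro ⟨a, -, rfl⟩; exact part_mem_parts π a⟩

end Parts

namespace IsCyclicSuccessor

variable {n : ℕ} {π : SetPartition n} {σ τ : Perm (Fin n)}

theorem unique (hσ : IsCyclicSuccessor π σ) (hτ : IsCyclicSuccessor π τ) : σ = τ := by
  ext1 a
  obtain ⟨hmemσ, hσa⟩ := hσ a
  obtain ⟨hmemτ, hτa⟩ := hτ a
  rcases hσa with ⟨hltσ, hnextσ⟩ | hwrapσ <;> rcases hτa with ⟨hltτ, hnextτ⟩ | hwrapτ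
  · exact le_antisymm (hnextσ _ hmemτ hltτ) (hnextτ _ hmemσ hltσ)
  · exact absurd (hwrapτ _ hmemσ).2 (not_le.2 hltσ)
  · exact absurd (hwrapσ _ hmemτ).2 (not_le.2 hltτ)
  · exact le_antisymm (hwrapσ _ hmemτ).1 (hwrapτ _ hmemσ).1

theorem part_apply (hσ : IsCyclicSuccessor π σ) (a : Fin n) : π.part (σ a) = π.part a :=
  mem_part_iff_part_eq.1 (hσ a).1

theorem part_eq_of_sameCycle (hσ : IsCyclicSuccessor π σ) {a b : Fin n} (h : σ.SameCycle a b) :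
    π.part b = π.part a := by
  obtain ⟨k, -, rfl⟩ := h.exists_pow_eq'
  clear h
  induction k with
  | zero => rfl
  | succ k ih => rw [pow_succ', Perm.mul_apply, hσ.part_apply, ih]

theorem sameCycle_of_forall_le (hσ : IsCyclicSuccessor π σ) {a : Fin n}
    (hmin : ∀ j ∈ π.part a, a ≤ j) (b : Fin n) (hb : π.part b = π.part a) : σ.SameCycle a b := by
  induction b using WellFoundedLT.induction with
  | _ b ih =>
    obtain ⟨c, rfl⟩ := σ.surjective b
    have hc : π.part c = π.part a := by rw [← hb, hσ.part_apply]
    rw [Perm.sameCycle_apply_right]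
    rcases (hσ c).2 with h | h
    · exact ih c h.1 hc
    · have hle : σ c ≤ a := (h a (mem_part_iff_part_eq.2 hc.symm)).1
      have hge : a ≤ σ c := hmin _ (mem_part_iff_part_eq.2 hb)
      rw [← Perm.sameCycle_apply_right, le_antisymm hle hge]

theorem sameCycle_iff (hσ : IsCyclicSuccessor π σ) {a b : Fin n} :
    σ.SameCycle a b ↔ π.part b = π.part a := by
  refine ⟨hσ.part_eq_of_sameCycle, fun h => ?_⟩
  let c := (π.part a).min' ⟨a, self_mem_part π a⟩
  have hc : π.part c = π.part a := mem_part_iff_part_eq.1 (Finset.min'_mem _ _)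
  have hmin : ∀ j ∈ π.part c, c ≤ j := by
    rw [hc]
    exact fun j hj => Finset.min'_le _ _ hj
  exact (hσ.sameCycle_of_forall_le hmin a hc.symm).symm.trans
    (hσ.sameCycle_of_forall_le hmin b (h.trans hc.symm))

theorem cyclePartition_eq (hσ : IsCyclicSuccessor π σ) : cyclePartition σ = π := by
  have hpart : (cyclePartition σ).part = π.part := by
    ext a b
    rw [mem_part_cyclePartition, hσ.sameCycle_iff, mem_part_iff_part_eq]
  exact Finpartition.ext (by rw [parts_eq_image_part, parts_eq_image_part, hpart])

theorem le_of_not_lt_apply (hσ : IsCyclicSuccessor π σ) {a b : Fin n} (ha : ¬a < σ a)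
    (hab : π.part b = π.part a) : b ≤ a := by
  rcases (hσ a).2 with h | h
  · exact absurd h.1 ha
  · exact (h b (mem_part_iff_part_eq.2 hab)).2

theorem le_card_ascents_add_card_parts (hσ : IsCyclicSuccessor π σ) :
    n ≤ (univ.filter fun a => a < σ a).card + π.parts.card := by
  have hnonascents : (univ.filter fun a => ¬a < σ a).card ≤ π.parts.card := by
    refine Finset.card_le_card_of_injOn π.part (fun a _ => part_mem_parts π a) ?_
    intro a ha b hb hab
    simp only [coe_filter, mem_univ, true_and, Set.mem_ofPred_eq] at ha hb
    exact le_antisymm (hσ.le_of_not_lt_apply hb hab) (hσ.le_of_not_lt_apply ha hab.symm)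
  have hcard := Finset.card_filter_add_card_filter_not (s := (univ : Finset (Fin n)))
    (fun a => a < σ a)
  rw [Finset.card_univ, Fintype.card_fin] at hcard
  omega

theorem notMem_Ioo_of_part_eq (hσ : IsCyclicSuccessor π σ) {a j : Fin n}
    (hj : π.part j = π.part a) : j ∉ Ioo a (σ a) := by
  rw [Finset.mem_Ioo]
  rintro ⟨haj, hja⟩
  rcases (hσ a).2 with ⟨-, hnext⟩ | hwrap
  · exact absurd (hnext j (mem_part_iff_part_eq.2 hj) haj) (not_le.2 hja)
  · exact absurd (hwrap j (mem_part_iff_part_eq.2 hj)).2 (not_le.2 haj)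

theorem mem_Ioo (hσ : IsCyclicSuccessor π σ) (hπ : IsNonCrossing π) {a s t : Fin n}
    (hst : π.part s = π.part t) (hs : s ∈ Ioo a (σ a)) : t ∈ Ioo a (σ a) := by
  have hne : π.part s ≠ π.part a := fun h => hσ.notMem_Ioo_of_part_eq h hs
  have hta : t ≠ a := by rintro rfl; exact hne hst
  have htσa : t ≠ σ a := by rintro rfl; exact hne (hst.trans (hσ.part_apply a))
  have hts : t ∈ π.part s := mem_part_iff_part_eq.2 hst.symm
  rw [Finset.mem_Ioo] at hs ⊢
  refine ⟨lt_of_not_ge fun hle => hne ?_, lt_of_not_ge fun hle => hne ?_⟩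
  · exact hπ _ (part_mem_parts π s) _ (part_mem_parts π a) t a s (σ a) (hle.lt_of_ne hta)
      hs.1 hs.2 hts (self_mem_part π s) (self_mem_part π a) (hσ a).1
  · exact (hπ _ (part_mem_parts π a) _ (part_mem_parts π s) a s (σ a) t hs.1 hs.2
      (hle.lt_of_ne htσa.symm) (self_mem_part π a) (hσ a).1 (self_mem_part π s) hts).symm

end IsCyclicSuccessor

theorem exists_cyclically_next {n : ℕ} (π : SetPartition n) (a : Fin n) :
    ∃ b ∈ π.part a, (a < b ∧ ∀ j ∈ π.part a, a < j → b ≤ j) ∨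
      ∀ j ∈ π.part a, b ≤ j ∧ j ≤ a := by
  by_cases hne : ((π.part a).filter (a < ·)).Nonempty
  · have hmin := Finset.mem_filter.1 (Finset.min'_mem _ hne)
    exact ⟨_, hmin.1, Or.inl ⟨hmin.2, fun j hj haj =>
      Finset.min'_le _ _ (Finset.mem_filter.2 ⟨hj, haj⟩)⟩⟩
  · refine ⟨(π.part a).min' ⟨a, self_mem_part π a⟩, Finset.min'_mem _ _, Or.inr fun j hj =>
      ⟨Finset.min'_le _ _ hj, not_lt.1 fun haj => ?_⟩⟩
    exact hne ⟨j, Finset.mem_filter.2 ⟨hj, haj⟩⟩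

theorem exists_isCyclicSuccessor {n : ℕ} (π : SetPartition n) :
    ∃ σ : Perm (Fin n), IsCyclicSuccessor π σ := by
  choose f hmem hnext using exists_cyclically_next π
  have hne (a b : Fin n) (hab : a < b) : f a ≠ f b := by
    intro heq
    have hpart : π.part b = π.part a := by
      rw [← mem_part_iff_part_eq.1 (hmem a), ← mem_part_iff_part_eq.1 (hmem b), heq]
    have hba : b ∈ π.part a := mem_part_iff_part_eq.2 hpart
    have hab' : a ∈ π.part b := mem_part_iff_part_eq.2 hpart.symm
    rcases hnext a with ⟨hlt, hnexta⟩ | hwrapa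
    · rcases hnext b with ⟨hltb, -⟩ | hwrapb
      · exact absurd (hnexta b hba hab) (not_le.2 (heq ▸ hltb))
      · exact absurd (hwrapb a hab').1 (not_le.2 (heq ▸ hlt))
    · exact absurd (hwrapa b hba).2 (not_le.2 hab)
  have hinj : Function.Injective f := .of_lt_imp_ne hne
  exact ⟨Equiv.ofBijective f (Finite.injective_iff_bijective.1 hinj), fun a => ⟨hmem a, hnext a⟩⟩

theorem finRotate_castSucc {m : ℕ} (i : Fin m) : finRotate (m + 1) i.castSucc = i.succ := by
  rw [finRotate_apply, Fin.coeSucc_eq_succ]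

theorem jointlyTransitive_of_mul_eq_finRotate {m : ℕ} {σ τ : Perm (Fin (m + 1))}
    (hτ : σ * τ = finRotate (m + 1)) : JointlyTransitive σ τ := by
  have hmem : finRotate (m + 1) ∈ Subgroup.closure {σ, τ} := by
    rw [← hτ]
    exact Subgroup.mul_mem _ (Subgroup.subset_closure (by simp)) (Subgroup.subset_closure (by simp))
  refine (MulAction.isPretransitive_iff_base (0 : Fin (m + 1))).2 fun b => ?_
  induction b using Fin.induction with
  | zero => exact ⟨1, rfl⟩
  | succ i ih =>
    obtain ⟨g, hg⟩ := ih
    refine ⟨⟨_, hmem⟩ * g, ?_⟩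
    rw [mul_smul, hg]
    exact finRotate_castSucc i

theorem cycleCount_finRotate (m : ℕ) : cycleCount (finRotate (m + 1)) = 1 := by
  rcases m with _ | m
  · rw [finRotate_one, ← Perm.one_def, cycleCount_one, Fintype.card_fin]
  · rw [cycleCount, Perm.parts_partition, cycleType_finRotate, support_finRotate, card_univ,
      Nat.sub_self, Multiset.replicate_zero, add_zero, Multiset.card_singleton]

theorem eq_of_finRotate_invariant {m : ℕ} {f : Fin (m + 1) → ℝ}
    (hf : f ∈ invariantFunctions (finRotate (m + 1))) (i j : Fin (m + 1)) : f i = f j :=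
  (jointlyTransitive_of_mul_eq_finRotate (one_mul _)).eq_of_invariant (fun _ => rfl) hf i j

theorem IsCyclicSuccessor.mem_Ico_iff {m : ℕ} {π : SetPartition (m + 1)}
    {σ τ : Perm (Fin (m + 1))} (hσ : IsCyclicSuccessor π σ) (hπ : IsNonCrossing π)
    (hτ : σ * τ = finRotate (m + 1)) {a : Fin (m + 1)} (ha : a < σ a) (i : Fin (m + 1)) :
    τ i ∈ Ico a (σ a) ↔ i ∈ Ico a (σ a) := by
  have hστ : σ (τ i) = finRotate (m + 1) i := by rw [← hτ]; rfl
  have hshift : τ i ∈ Ico a (σ a) ↔ σ (τ i) ∈ Ioc a (σ a) := by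
    have hIco : τ i ∈ Ico a (σ a) ↔ τ i = a ∨ τ i ∈ Ioo a (σ a) := by
      rw [← Finset.Ioo_insert_left ha, Finset.mem_insert]
    have hIoc : σ (τ i) ∈ Ioc a (σ a) ↔ σ (τ i) = σ a ∨ σ (τ i) ∈ Ioo a (σ a) := by
      rw [← Finset.Ioo_insert_right ha, Finset.mem_insert]
    rw [hIco, hIoc, σ.injective.eq_iff]
    exact or_congr Iff.rfl ⟨hσ.mem_Ioo hπ (hσ.part_apply _).symm,
      hσ.mem_Ioo hπ (hσ.part_apply _)⟩
  rw [hshift, hστ, Finset.mem_Ioc, Finset.mem_Ico, Fin.lt_def, Fin.le_def, Fin.le_def, Fin.lt_def,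
    coe_finRotate]
  split_ifs with hi
  · rw [hi, Fin.val_last]
    omega
  · have := Fin.val_lt_last hi
    omega

theorem IsCyclicSuccessor.mem_Ico_of_sameCycle {m : ℕ} {π : SetPartition (m + 1)}
    {σ τ : Perm (Fin (m + 1))} (hσ : IsCyclicSuccessor π σ) (hπ : IsNonCrossing π)
    (hτ : σ * τ = finRotate (m + 1)) {a b : Fin (m + 1)} (ha : a < σ a) (hab : τ.SameCycle a b) :
    b ∈ Ico a (σ a) := by
  have hinv : (fun i => if i ∈ Ico a (σ a) then (1 : ℝ) else 0) ∈ invariantFunctions τ :=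
    fun i => by simp only [hσ.mem_Ico_iff hπ hτ ha i]
  by_contra hb
  have heq := eq_of_sameCycle hinv hab
  rw [if_pos (left_mem_Ico.2 ha), if_neg hb] at heq
  exact one_ne_zero heq

theorem IsCyclicSuccessor.card_ascents_lt {m : ℕ} {π : SetPartition (m + 1)}
    {σ τ : Perm (Fin (m + 1))} (hσ : IsCyclicSuccessor π σ) (hπ : IsNonCrossing π)
    (hτ : σ * τ = finRotate (m + 1)) :
    (univ.filter fun a => a < σ a).card < cycleCount τ := by
  have hlast : Fin.last m ∉ univ.filter fun a => a < σ a := by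
    rw [mem_filter_univ, not_lt]
    exact Fin.le_last _
  rw [← Nat.succ_le_iff, Nat.succ_eq_add_one, ← Finset.card_insert_of_notMem hlast,
    cycleCount_eq_card_parts]
  refine Finset.card_le_card_of_injOn (cyclePartition τ).part (fun a _ => part_mem_parts _ a) ?_
  intro a ha b hb hab
  have hsame : τ.SameCycle a b := by
    rw [← mem_part_cyclePartition, mem_part_iff_part_eq, hab]
  have hsep {a b : Fin (m + 1)} (ha : a < σ a) (hab : τ.SameCycle a b) : a ≤ b ∧ b < σ a :=
    Finset.mem_Ico.1 (hσ.mem_Ico_of_sameCycle hπ hτ ha hab)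
  simp only [coe_insert, coe_filter, mem_univ, true_and, Set.mem_insert_iff,
    Set.mem_ofPred_eq] at ha hb
  rcases ha with rfl | ha <;> rcases hb with rfl | hb
  · rfl
  · exact absurd (hsep hb hsame.symm).2 (not_lt.2 (Fin.le_last _))
  · exact absurd (hsep ha hsame).2 (not_lt.2 (Fin.le_last _))
  · exact le_antisymm (hsep ha hsame).1 (hsep hb hsame.symm).1

theorem IsCyclicSuccessor.cycleCount_add {m : ℕ} {π : SetPartition (m + 1)}
    {σ τ : Perm (Fin (m + 1))} (hσ : IsCyclicSuccessor π σ) (hπ : IsNonCrossing π)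
    (hτ : σ * τ = finRotate (m + 1)) : cycleCount σ + cycleCount τ = m + 2 := by
  have hle := cycleCount_add_le (jointlyTransitive_of_mul_eq_finRotate hτ)
  have hparts := hσ.le_card_ascents_add_card_parts
  have hascents := hσ.card_ascents_lt hπ hτ
  rw [Fintype.card_fin] at hle
  rw [← hσ.cyclePartition_eq, ← cycleCount_eq_card_parts] at hparts
  omega

theorem ite_le_finRotate {m : ℕ} (b i : Fin (m + 1)) :
    (if b ≤ finRotate (m + 1) i then (1 : ℝ) else 0) =
      (if b ≤ i then 1 else 0) + (if finRotate (m + 1) i = b then 1 else 0) -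
        if i = Fin.last m then 1 else 0 := by
  cases i using Fin.lastCases with
  | last => simp [Fin.le_last, eq_comm]
  | cast i =>
    simp only [Fin.le_castSucc_iff]
    rw [finRotate_castSucc, if_neg (Fin.castSucc_lt_last i).ne, sub_zero]
    rcases lt_trichotomy b i.succ with h | h | h
    · simp [h, h.le, h.ne']
    · simp [h]
    · simp [not_le.2 h, not_lt.2 h.le, h.ne]

theorem interval_mem_invariantFunctions {m : ℕ} {σ τ : Perm (Fin (m + 1))}
    (hτ : σ * τ = finRotate (m + 1)) (hc : cycleCount σ + cycleCount τ = m + 2)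
    (a : Fin (m + 1)) :
    (fun j => (if σ a ≤ j then (1 : ℝ) else 0) - if a < j then 1 else 0) ∈
      invariantFunctions σ := by
  have htop := sup_invariantFunctions_eq_top (jointlyTransitive_of_mul_eq_finRotate hτ)
    (by rw [Fintype.card_fin]; exact hc)
  obtain ⟨g, hg, h, hh, hgh⟩ := Submodule.mem_sup.1
    (htop.ge (Submodule.mem_top (x := fun j => if j = a then (1 : ℝ) else 0)))
  have hdelta (j : Fin (m + 1)) : g j + h j = if j = a then (1 : ℝ) else 0 := congrFun hgh j
  have hstep (i : Fin (m + 1)) : h (finRotate (m + 1) i) - h i =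
      (if finRotate (m + 1) i = a then (1 : ℝ) else 0) -
        if finRotate (m + 1) i = σ a then 1 else 0 := by
    have hgτ : g (finRotate (m + 1) i) = g (τ i) := by rw [← hτ]; exact hg (τ i)
    have hiff : τ i = a ↔ finRotate (m + 1) i = σ a := by
      rw [← hτ, Perm.mul_apply, σ.injective.eq_iff]
    have hdeltaτ := hdelta (τ i)
    rw [hh i, ← hgτ] at hdeltaτ
    simp only [hiff] at hdeltaτ
    linarith [hdelta (finRotate (m + 1) i)]
  have hconst := eq_of_finRotate_invariant
    (f := fun j => h j - ((if a ≤ j then 1 else 0) - if σ a ≤ j then 1 else 0)) fun i => by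
      beta_reduce
      rw [ite_le_finRotate, ite_le_finRotate]
      linarith [hstep i]
  have hle (j : Fin (m + 1)) : (if a ≤ j then (1 : ℝ) else 0) =
      (if j = a then 1 else 0) + if a < j then 1 else 0 := by
    rcases lt_trichotomy a j with hj | hj | hj
    · simp [hj, hj.le, hj.ne']
    · simp [hj]
    · simp [not_le.2 hj, not_lt.2 hj.le, hj.ne]
  intro j
  linarith [hg j, hdelta j, hdelta (σ j), hconst j (σ j), hle j, hle (σ j)]

theorem isCyclicSuccessor_cyclePartition {m : ℕ} {σ τ : Perm (Fin (m + 1))}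
    (hτ : σ * τ = finRotate (m + 1)) (hc : cycleCount σ + cycleCount τ = m + 2) :
    IsCyclicSuccessor (cyclePartition σ) σ := by
  intro a
  refine ⟨mem_part_cyclePartition.2 (Perm.sameCycle_apply_right.2 (Perm.SameCycle.refl _ _)), ?_⟩
  have hinv {j : Fin (m + 1)} (hj : j ∈ (cyclePartition σ).part a) :=
    eq_of_sameCycle (interval_mem_invariantFunctions hτ hc a) (mem_part_cyclePartition.1 hj)
  simp only [lt_irrefl, if_false, sub_zero] at hinv
  rcases lt_or_ge a (σ a) with hlt | hge
  · refine Or.inl ⟨hlt, fun j hj haj => ?_⟩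
    by_contra hj'
    have heq := hinv hj
    rw [if_neg (not_le.2 hlt), if_neg hj', if_pos haj] at heq
    norm_num at heq
  · refine Or.inr fun j hj => ?_
    have heq := hinv hj
    rw [if_pos hge] at heq
    constructor <;> by_contra hj'
    · rw [if_neg hj', if_neg (not_lt.2 ((not_le.1 hj').le.trans hge))] at heq
      norm_num at heq
    · rw [if_pos (hge.trans (not_le.1 hj').le), if_pos (not_le.1 hj')] at heq
      norm_num at heq

theorem isNonCrossing_cyclePartition {m : ℕ} {σ τ : Perm (Fin (m + 1))}
    (hτ : σ * τ = finRotate (m + 1)) (hc : cycleCount σ + cycleCount τ = m + 2) :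
    IsNonCrossing (cyclePartition σ) := by
  intro V hV W hW a b c e hab hbc hce haV hcV hbW heW
  by_contra hVW
  have hne : (V.filter (· < b)).Nonempty := ⟨a, Finset.mem_filter.2 ⟨haV, hab⟩⟩
  obtain ⟨x, hx, hmax⟩ := Finset.exists_max_image _ id hne
  obtain ⟨hxV, hxb⟩ := Finset.mem_filter.1 hx
  obtain ⟨hmem, hnext⟩ := isCyclicSuccessor_cyclePartition hτ hc x
  rw [Finpartition.part_eq_of_mem _ hV hxV] at hmem hnext
  rcases hnext with ⟨hlt, hnext⟩ | hwrap
  · have hxc : σ x ≤ c := hnext c hcV (hxb.trans hbc)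
    have hbx : ¬σ x ≤ b := fun hle => by
      rcases hle.lt_or_eq with hlt' | heq
      · exact absurd (hmax _ (Finset.mem_filter.2 ⟨hmem, hlt'⟩)) (not_le.2 hlt)
      · exact hVW (Finpartition.eq_of_mem_parts _ hV hW (heq ▸ hmem) hbW)
    have hbe : σ.SameCycle b e := mem_part_cyclePartition.1 <| by
      rwa [Finpartition.part_eq_of_mem _ hW hbW]
    have heq := eq_of_sameCycle (interval_mem_invariantFunctions hτ hc x) hbe
    rw [if_neg hbx, if_pos hxb, if_pos (hxc.trans hce.le), if_pos (hxb.trans (hbc.trans hce))]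
      at heq
    norm_num at heq
  · exact absurd (hwrap c hcV).2 (not_le.2 (hxb.trans hbc))

theorem mem_NC {n : ℕ} {π : SetPartition n} : π ∈ NC n ↔ IsNonCrossing π := by
  simp [NC]

theorem sum_genus_zero_eq_sum_NC (u : ℕ → ℝ) (m : ℕ) :
    ∑ σ : Perm (Fin (m + 1)) with
        cycleCount σ + cycleCount (σ⁻¹ * finRotate (m + 1)) = m + 2, cycleWeight u σ =
      ∑ π ∈ NC (m + 1), blockProd u π := by
  have hmul (σ : Perm (Fin (m + 1))) : σ * (σ⁻¹ * finRotate (m + 1)) = finRotate (m + 1) :=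
    mul_inv_cancel_left _ _
  refine Finset.sum_bij (fun σ _ => cyclePartition σ) (fun σ hσ => ?_) (fun σ hσ τ hτ heq => ?_)
    (fun π hπ => ?_) (fun σ _ => cycleWeight_eq_prod u σ)
  · exact mem_NC.2 (isNonCrossing_cyclePartition (hmul σ) (Finset.mem_filter.1 hσ).2)
  · have hσ' := isCyclicSuccessor_cyclePartition (hmul σ) (Finset.mem_filter.1 hσ).2
    have hτ' := isCyclicSuccessor_cyclePartition (hmul τ) (Finset.mem_filter.1 hτ).2
    exact hσ'.unique (heq ▸ hτ')
  · obtain ⟨σ, hσ⟩ := exists_isCyclicSuccessor π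
    exact ⟨σ, Finset.mem_filter.2 ⟨mem_univ _, hσ.cycleCount_add (mem_NC.1 hπ) (hmul σ)⟩,
      hσ.cyclePartition_eq⟩

end NonCrossing

/-! ### The exponential formula for pairs of permutations -/

section FormalExponential

/-- `a` is the formal exponential of `c`: with `A = ∑ aₙ tⁿ / n!` and `C = ∑_{n ≥ 1} cₙ tⁿ / n!`
one has `A = exp C`, expressed as `A(0) = 1` and `A' = C' A` so that no division is needed. The
sequence `c` only enters through its terms of positive index. -/
structure IsFormalExp {R : Type*} [CommSemiring R] (a c : ℕ → R) : Prop where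
  zero : a 0 = 1
  succ (n : ℕ) : a (n + 1) = ∑ k ∈ range (n + 1), (n.choose k : R) * (c (k + 1) * a (n - k))

theorem IsFormalExp.left_unique {R : Type*} [CommSemiring R] {a b c : ℕ → R}
    (ha : IsFormalExp a c) (hb : IsFormalExp b c) : a = b := by
  funext n
  induction n using Nat.strong_induction_on with
  | _ n ih =>
    rcases n with _ | n
    · rw [ha.zero, hb.zero]
    · rw [ha.succ, hb.succ]
      exact Finset.sum_congr rfl fun k _ => by rw [ih (n - k) (by omega)]

theorem IsFormalExp.right_unique {R : Type*} [CommRing R] {a b c : ℕ → R}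
    (hb : IsFormalExp a b) (hc : IsFormalExp a c) (n : ℕ) : b (n + 1) = c (n + 1) := by
  induction n using Nat.strong_induction_on with
  | _ n ih =>
    have hsum := (hb.succ n).symm.trans (hc.succ n)
    rw [Finset.sum_range_succ, Finset.sum_range_succ, Finset.sum_congr rfl fun k hk => by
      rw [ih k (mem_range.1 hk)], add_right_inj] at hsum
    simpa only [Nat.choose_self, Nat.cast_one, one_mul, Nat.sub_self, hb.zero, mul_one] using hsum

end FormalExponential

section PairSums

/-- The orbit of `a` under the group generated by `σ` and `τ`. -/
abbrev jointOrbit {α : Type*} (σ τ : Perm α) (a : α) : Set α :=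
  MulAction.orbit (Subgroup.closure {σ, τ}) a

theorem jointlyTransitive_iff_jointOrbit_eq_univ {α : Type*} {σ τ : Perm α} (a : α) :
    JointlyTransitive σ τ ↔ jointOrbit σ τ a = Set.univ :=
  MulAction.isPretransitive_iff_orbit_eq_univ a

theorem apply_mem_jointOrbit_iff {α : Type*} {σ τ g : Perm α} {a : α}
    (hg : g ∈ Subgroup.closure {σ, τ}) (b : α) : g b ∈ jointOrbit σ τ a ↔ b ∈ jointOrbit σ τ a := by
  rw [← MulAction.orbit_eq_iff, ← MulAction.orbit_eq_iff]
  exact Eq.congr_left (MulAction.orbit_smul (⟨g, hg⟩ : Subgroup.closure {σ, τ}) b)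

theorem semiconj_of_mem_closure {α β : Type*} {f : α → β} {s : Set (Perm α × Perm β)}
    (hs : ∀ g ∈ s, Function.Semiconj f g.1 g.2) {g : Perm α × Perm β}
    (hg : g ∈ Subgroup.closure s) : Function.Semiconj f g.1 g.2 := by
  induction hg using Subgroup.closure_induction with
  | mem g hg => exact hs g hg
  | one => exact fun _ => rfl
  | mul g h _ _ hg hh => exact hg.comp_right hh
  | inv g _ hg => exact hg.inverses_right g.1.apply_symm_apply g.2.symm_apply_apply

theorem image_jointOrbit {α β : Type*} {f : α → β} {σ τ : Perm α} {σ' τ' : Perm β}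
    (hσ : Function.Semiconj f σ σ') (hτ : Function.Semiconj f τ τ') (a : α) :
    f '' jointOrbit σ τ a = jointOrbit σ' τ' (f a) := by
  let K := Subgroup.closure {(σ, σ'), (τ, τ')}
  have hsemiconj {g : Perm α × Perm β} (hg : g ∈ K) : Function.Semiconj f g.1 g.2 :=
    semiconj_of_mem_closure (by rintro _ (rfl | rfl) <;> assumption) hg
  have hfst : K.map (MonoidHom.fst _ _) = Subgroup.closure {σ, τ} := by
    rw [MonoidHom.map_closure, Set.image_pair]; rfl
  have hsnd : K.map (MonoidHom.snd _ _) = Subgroup.closure {σ', τ'} := by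
    rw [MonoidHom.map_closure, Set.image_pair]; rfl
  ext b
  constructor
  · rintro ⟨_, ⟨⟨g, hg⟩, rfl⟩, rfl⟩
    obtain ⟨k, hk, rfl⟩ := hfst.ge hg
    exact ⟨⟨k.2, hsnd.le ⟨k, hk, rfl⟩⟩, (hsemiconj hk a).symm⟩
  · rintro ⟨⟨g, hg⟩, rfl⟩
    obtain ⟨k, hk, rfl⟩ := hsnd.ge hg
    exact ⟨k.1 a, ⟨⟨k.1, hfst.le ⟨k, hk, rfl⟩⟩, rfl⟩, hsemiconj hk a⟩

theorem JointlyTransitive.of_semiconj {α β : Type*} {f : α → β} (hf : Function.Surjective f)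
    {σ τ : Perm α} {σ' τ' : Perm β} (hσ : Function.Semiconj f σ σ')
    (hτ : Function.Semiconj f τ τ') (h : JointlyTransitive σ τ) : JointlyTransitive σ' τ' := by
  rcases isEmpty_or_nonempty α with _ | ⟨⟨a⟩⟩
  · have := hf.isEmpty
    exact ⟨isEmptyElim⟩
  · rw [jointlyTransitive_iff_jointOrbit_eq_univ (f a), ← image_jointOrbit hσ hτ,
      (jointlyTransitive_iff_jointOrbit_eq_univ a).1 h, Set.image_univ, hf.range_eq]

theorem jointlyTransitive_permCongr_iff {α β : Type*} (e : α ≃ β) {σ τ : Perm α} :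
    JointlyTransitive (e.permCongr σ) (e.permCongr τ) ↔ JointlyTransitive σ τ :=
  ⟨.of_semiconj e.symm.surjective (fun b => by simp [permCongr_apply])
      fun b => by simp [permCongr_apply],
    .of_semiconj e.surjective (fun a => by simp [permCongr_apply])
      fun a => by simp [permCongr_apply]⟩

section Glue

variable {α : Type*} {p : α → Prop} [DecidablePred p]

theorem exists_subtypeCongr_eq {g : Perm α} (h : ∀ a, p (g a) ↔ p a) :
    ∃ (σ : Perm {a // p a}) (τ : Perm {a // ¬p a}), Perm.subtypeCongr σ τ = g := by
  refine ⟨g.subtypePerm h, g.subtypePerm (fun a => not_congr (h a)), ?_⟩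
  ext a
  by_cases ha : p a
  · rw [Perm.subtypeCongr.left_apply _ _ ha]; rfl
  · rw [Perm.subtypeCongr.right_apply _ _ ha]; rfl

/-- The pair of permutations that acts as `q.1` on `p` and as `q.2` on its complement. -/
def gluePair (q : (Perm {a // p a} × Perm {a // p a}) × (Perm {a // ¬p a} × Perm {a // ¬p a})) :
    Perm α × Perm α :=
  (Perm.subtypeCongr q.1.1 q.2.1, Perm.subtypeCongr q.1.2 q.2.2)

theorem gluePair_injective : Function.Injective (gluePair (p := p)) := by
  rintro ⟨⟨σ, τ⟩, σ', τ'⟩ ⟨⟨ρ, π⟩, ρ', π'⟩ h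
  obtain ⟨hfst, hsnd⟩ := Prod.ext_iff.1 h
  obtain ⟨rfl, rfl⟩ :=
    Prod.ext_iff.1 (Perm.subtypeCongrHom_injective p (a₁ := (σ, σ')) (a₂ := (ρ, ρ')) hfst)
  obtain ⟨rfl, rfl⟩ :=
    Prod.ext_iff.1 (Perm.subtypeCongrHom_injective p (a₁ := (τ, τ')) (a₂ := (π, π')) hsnd)
  rfl

theorem jointOrbit_gluePair_eq_iff {a : α} (ha : p a)
    (q : (Perm {a // p a} × Perm {a // p a}) × (Perm {a // ¬p a} × Perm {a // ¬p a})) :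
    jointOrbit (gluePair q).1 (gluePair q).2 a = {b | p b} ↔ JointlyTransitive q.1.1 q.1.2 := by
  have himage : Subtype.val '' jointOrbit q.1.1 q.1.2 ⟨a, ha⟩ =
      jointOrbit (gluePair q).1 (gluePair q).2 a :=
    image_jointOrbit (fun b => (Perm.subtypeCongr.left_apply_subtype _ _ b).symm)
      (fun b => (Perm.subtypeCongr.left_apply_subtype _ _ b).symm) _
  rw [jointlyTransitive_iff_jointOrbit_eq_univ (⟨a, ha⟩ : {a // p a}), ← himage,
    ← Subtype.val_injective.image_injective.eq_iff, Set.image_univ, Subtype.range_coe_subtype]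

theorem exists_gluePair_eq {a : α} {g : Perm α × Perm α} (hg : jointOrbit g.1 g.2 a = {b | p b}) :
    ∃ q, gluePair (p := p) q = g := by
  have hmem {k : Perm α} (hk : k ∈ Subgroup.closure {g.1, g.2}) (b : α) : p (k b) ↔ p b := by
    have hiff := apply_mem_jointOrbit_iff (a := a) hk b
    rwa [hg] at hiff
  obtain ⟨σ, σ', hσ⟩ := exists_subtypeCongr_eq (hmem (Subgroup.subset_closure (Set.mem_insert _ _)))
  obtain ⟨τ, τ', hτ⟩ := exists_subtypeCongr_eq
    (hmem (Subgroup.subset_closure (Set.mem_insert_of_mem _ rfl)))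
  exact ⟨((σ, τ), (σ', τ')), Prod.ext hσ hτ⟩

end Glue

variable {R : Type*} [CommSemiring R]

/-- The sum of `x_σ y_τ` over all pairs of permutations. -/
def totalPairSum (α : Type*) [Fintype α] [DecidableEq α] (x y : ℕ → R) : R :=
  ∑ p : Perm α × Perm α, cycleWeight x p.1 * cycleWeight y p.2

open Classical in
/-- The sum of `x_σ y_τ` over the pairs of permutations that generate a transitive group. -/
def transitivePairSum (α : Type*) [Fintype α] [DecidableEq α] (x y : ℕ → R) : R :=
  ∑ p : Perm α × Perm α with JointlyTransitive p.1 p.2, cycleWeight x p.1 * cycleWeight y p.2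

variable {α β : Type*} [Fintype α] [DecidableEq α] [Fintype β] [DecidableEq β]

theorem totalPairSum_congr (e : α ≃ β) (x y : ℕ → R) :
    totalPairSum α x y = totalPairSum β x y := by
  refine Fintype.sum_equiv (e.permCongr.prodCongr e.permCongr) _ _ fun p => ?_
  simp only [prodCongr_apply, Prod.map_fst, Prod.map_snd, cycleWeight_permCongr]

theorem transitivePairSum_congr (e : α ≃ β) (x y : ℕ → R) :
    transitivePairSum α x y = transitivePairSum β x y := by
  classical
  refine Finset.sum_equiv (e.permCongr.prodCongr e.permCongr) (fun p => ?_) fun p _ => ?_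
  · simp only [mem_filter_univ, prodCongr_apply, Prod.map_fst, Prod.map_snd,
      jointlyTransitive_permCongr_iff]
  · simp only [prodCongr_apply, Prod.map_fst, Prod.map_snd, cycleWeight_permCongr]

open Classical in
theorem sum_jointOrbit_eq (B : Finset α) {a : α} (ha : a ∈ B) (x y : ℕ → R) :
    ∑ p : Perm α × Perm α with jointOrbit p.1 p.2 a = B, cycleWeight x p.1 * cycleWeight y p.2 =
      transitivePairSum {b // b ∈ B} x y * totalPairSum {b // b ∉ B} x y := by
  have hB : (B : Set α) = {b | b ∈ B} := rfl
  rw [transitivePairSum, totalPairSum, Finset.sum_mul_sum, ← Finset.sum_product']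
  symm
  refine Finset.sum_bij (fun q _ => gluePair (p := (· ∈ B)) q) (fun q hq => ?_)
    (fun q _ q' _ h => gluePair_injective h) (fun g hg => ?_) fun q _ => ?_
  · rw [mem_product, mem_filter_univ] at hq
    rw [mem_filter_univ, hB, jointOrbit_gluePair_eq_iff ha]
    exact hq.1
  · rw [mem_filter_univ, hB] at hg
    obtain ⟨q, rfl⟩ := exists_gluePair_eq hg
    rw [jointOrbit_gluePair_eq_iff ha] at hg
    exact ⟨q, Finset.mem_product.2 ⟨(mem_filter_univ _).2 hg, mem_univ _⟩, rfl⟩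
  · simp only [gluePair]
    rw [cycleWeight_subtypeCongr, cycleWeight_subtypeCongr]
    ring

theorem totalPairSum_eq_sum_jointOrbit (a : α) (x y : ℕ → R) :
    totalPairSum α x y = ∑ B ∈ (univ.erase a).powerset,
      transitivePairSum {b // b ∈ insert a B} x y * totalPairSum {b // b ∉ insert a B} x y := by
  classical
  have horbit (p : Perm α × Perm α) (B : Finset α) :
      (jointOrbit p.1 p.2 a).toFinset = B ↔ jointOrbit p.1 p.2 a = B := by
    rw [← Finset.coe_inj, Set.coe_toFinset]
  have hinj : Set.InjOn (insert a) ((univ.erase a).powerset : Set (Finset α)) := by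
    intro B hB C hC h
    have hnot {D : Finset α} (hD : D ∈ (univ.erase a).powerset) : a ∉ D := fun h =>
      Finset.notMem_erase a univ (Finset.mem_powerset.1 hD h)
    rw [← Finset.erase_insert (hnot hB), h, Finset.erase_insert (hnot hC)]
  have himage : (univ.erase a).powerset.image (insert a) = univ.filter (a ∈ ·) := by
    ext B
    rw [mem_image, mem_filter_univ]
    refine ⟨by rintro ⟨C, -, rfl⟩; exact mem_insert_self a C, fun hB => ⟨B.erase a, ?_, ?_⟩⟩
    · exact Finset.mem_powerset.2 (Finset.erase_subset_erase _ (subset_univ _))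
    · exact Finset.insert_erase hB
  rw [← Finset.sum_image hinj (f := fun B => transitivePairSum {b // b ∈ B} x y *
    totalPairSum {b // b ∉ B} x y), himage, totalPairSum,
    ← Finset.sum_fiberwise_of_maps_to (g := fun p => (jointOrbit p.1 p.2 a).toFinset)
      (t := univ.filter (a ∈ ·)) fun p _ => by simp]
  refine Finset.sum_congr rfl fun B hB => ?_
  simp only [horbit]
  exact sum_jointOrbit_eq B (Finset.mem_filter.1 hB).2 x y

theorem totalPairSum_succ (n : ℕ) (x y : ℕ → R) :
    totalPairSum (Fin (n + 1)) x y = ∑ k ∈ range (n + 1),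
      (n.choose k : R) * (transitivePairSum (Fin (k + 1)) x y *
        totalPairSum (Fin (n - k)) x y) := by
  have hpowerset := Finset.sum_powerset_apply_card (x := univ.erase (0 : Fin (n + 1)))
    fun k => transitivePairSum (Fin (k + 1)) x y * totalPairSum (Fin (n - k)) x y
  rw [card_erase_of_mem (mem_univ _), card_univ, Fintype.card_fin, Nat.add_sub_cancel] at hpowerset
  simp only [nsmul_eq_mul] at hpowerset
  rw [totalPairSum_eq_sum_jointOrbit 0, ← hpowerset]
  refine Finset.sum_congr rfl fun B hB => ?_
  have hB0 : (0 : Fin (n + 1)) ∉ B := fun h =>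
    Finset.notMem_erase _ _ (Finset.mem_powerset.1 hB h)
  have hcompl : Fintype.card {b // b ∉ insert 0 B} = n - B.card := by
    rw [Fintype.card_of_subtype (univ \ insert 0 B) (by simp), Finset.card_univ_sdiff,
      Finset.card_insert_of_notMem hB0, Fintype.card_fin, Nat.add_sub_add_right]
  rw [transitivePairSum_congr (Finset.equivFinOfCardEq (Finset.card_insert_of_notMem hB0)),
    totalPairSum_congr (Fintype.equivFinOfCardEq hcompl)]

theorem isFormalExp_totalPairSum (x y : ℕ → R) :
    IsFormalExp (fun n => totalPairSum (Fin n) x y) (fun n => transitivePairSum (Fin n) x y) where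
  zero := by
    simp [totalPairSum, cycleWeight, Perm.parts_partition, Subsingleton.elim _ (1 : Perm (Fin 0))]
  succ n := totalPairSum_succ n x y

end PairSums

/-! ### Cumulants over set partitions -/

section SetPartitions

variable {α : Type*} [DecidableEq α] {s : Finset α}

theorem sup_erase_parts (π : Finpartition s) {V : Finset α} (hV : V ∈ π.parts) :
    (π.parts.erase V).sup id = s \ V := by
  ext a
  simp only [Finset.mem_sup, mem_erase, id, Finset.mem_sdiff]
  constructor
  · rintro ⟨W, ⟨hne, hW⟩, ha⟩
    exact ⟨π.le hW ha, fun haV => hne (π.eq_of_mem_parts hW hV ha haV)⟩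
  · rintro ⟨ha, haV⟩
    obtain ⟨W, hW, haW⟩ := π.exists_mem ha
    exact ⟨W, ⟨fun h => haV (h ▸ haW), hW⟩, haW⟩

theorem notMem_parts_sdiff {V : Finset α} (hV : V.Nonempty) (ρ : Finpartition (s \ V)) :
    V ∉ ρ.parts := fun h =>
  let ⟨_, ha⟩ := hV
  (Finset.mem_sdiff.1 (ρ.le h ha)).2 ha

theorem sum_finpartition_sum_parts {M : Type*} [AddCommMonoid M]
    (F : Finset α → Finset (Finset α) → M) :
    ∑ π : Finpartition s, ∑ V ∈ π.parts, F V (π.parts.erase V) =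
      ∑ V ∈ s.powerset.erase ∅, ∑ ρ : Finpartition (s \ V), F V ρ.parts := by
  have hmem {V : Finset α} (hV : V ∈ s.powerset.erase ∅) : V.Nonempty ∧ V ⊆ s :=
    ⟨Finset.nonempty_iff_ne_empty.2 (Finset.ne_of_mem_erase hV),
      Finset.mem_powerset.1 (Finset.mem_of_mem_erase hV)⟩
  rw [Finset.sum_sigma', Finset.sum_sigma']
  symm
  refine Finset.sum_bij (fun q hq => ⟨q.2.extend (hmem (Finset.mem_sigma.1 hq).1).1.ne_empty
    Finset.sdiff_disjoint (Finset.sdiff_union_of_subset (hmem (Finset.mem_sigma.1 hq).1).2), q.1⟩)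
    (fun q _ => ?_) ?_ ?_ fun q hq => ?_
  · exact Finset.mem_sigma.2 ⟨mem_univ _, mem_insert_self _ _⟩
  · rintro ⟨V, ρ⟩ hV ⟨W, ρ'⟩ _ h
    obtain ⟨hext, hVW⟩ := Sigma.ext_iff.1 h
    obtain rfl : V = W := eq_of_heq hVW
    have hparts : insert V ρ.parts = insert V ρ'.parts := congrArg Finpartition.parts hext
    have hnot (ρ : Finpartition (s \ V)) : V ∉ ρ.parts :=
      notMem_parts_sdiff (hmem (Finset.mem_sigma.1 hV).1).1 ρ
    obtain rfl : ρ = ρ' := Finpartition.ext (by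
      rw [← Finset.erase_insert (hnot ρ), hparts, Finset.erase_insert (hnot ρ')])
    rfl
  · rintro ⟨π, V⟩ hV
    have hVπ := (Finset.mem_sigma.1 hV).2
    refine ⟨⟨V, π.ofSubset (Finset.erase_subset _ _) (sup_erase_parts π hVπ)⟩,
      Finset.mem_sigma.2 ⟨?_, mem_univ _⟩, ?_⟩
    · exact Finset.mem_erase.2 ⟨π.ne_empty hVπ, Finset.mem_powerset.2 (π.subset hVπ)⟩
    · exact Sigma.ext (Finpartition.ext (Finset.insert_erase hVπ)) HEq.rfl
  · exact congrArg (F q.1) (Finset.erase_insert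
      (notMem_parts_sdiff (hmem (Finset.mem_sigma.1 hq).1).1 q.2)).symm

variable {R : Type*} [CommRing R]

/-- The Möbius function of the lattice of set partitions, between a partition into `m` blocks and
the one-block partition. -/
def partitionMoebius (R : Type*) [CommRing R] (m : ℕ) : R :=
  (-1) ^ (m - 1) * ((m - 1).factorial : R)

theorem partitionMoebius_succ (m : ℕ) :
    partitionMoebius R (m + 1) + m * partitionMoebius R m = if m = 0 then 1 else 0 := by
  rcases m with _ | m
  · simp [partitionMoebius]
  · simp only [partitionMoebius, Nat.add_sub_cancel, Nat.factorial_succ, pow_succ,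
      Nat.succ_ne_zero, if_false]
    push_cast
    ring

/-- The (classical) cumulant of `a` over the set `s`, by Möbius inversion over its partitions. -/
def cumulantSum (a : ℕ → R) (s : Finset α) : R :=
  ∑ π : Finpartition s, partitionMoebius R π.parts.card * ∏ V ∈ π.parts, a V.card

theorem sum_parts_notMem_eq (a : ℕ → R) (π : Finpartition s) {x : α} (hx : x ∈ s) :
    ∑ V ∈ π.parts, (if x ∈ V then 0 else a V.card * (partitionMoebius R (π.parts.erase V).card *
        ∏ W ∈ π.parts.erase V, a W.card)) =
      ((π.parts.card - 1 : ℕ) : R) * partitionMoebius R (π.parts.card - 1) *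
        ∏ V ∈ π.parts, a V.card := by
  have hfilter : π.parts.filter (x ∉ ·) = π.parts.erase (π.part x) := by
    rw [← Finset.filter_ne']
    exact Finset.filter_congr fun V hV => not_congr (by rw [eq_comm, π.part_eq_iff_mem hV])
  simp only [← ite_not (p := x ∈ _)]
  rw [← Finset.sum_filter, Finset.sum_congr rfl (g := fun _ =>
    partitionMoebius R (π.parts.card - 1) * ∏ V ∈ π.parts, a V.card) fun V hV => ?_,
    Finset.sum_const, hfilter, Finset.card_erase_of_mem (π.part_mem.2 hx), nsmul_eq_mul, mul_assoc]
  have hVπ := (Finset.mem_filter.1 hV).1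
  rw [Finset.card_erase_of_mem hVπ, ← Finset.mul_prod_erase _ _ hVπ]
  ring

theorem sum_powerset_erase_mul_cumulantSum (a : ℕ → R) {x : α} (hx : x ∉ s) :
    ∑ V ∈ s.powerset.erase ∅, a V.card * cumulantSum a (insert x s \ V) =
      ∑ π : Finpartition (insert x s), ((π.parts.card - 1 : ℕ) : R) *
        partitionMoebius R (π.parts.card - 1) * ∏ V ∈ π.parts, a V.card := by
  have hfilter : s.powerset.erase ∅ = ((insert x s).powerset.erase ∅).filter (x ∉ ·) := by
    ext V
    simp only [mem_filter, mem_erase, Finset.mem_powerset, and_assoc]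
    refine and_congr_right fun _ => ⟨fun h => ⟨h.trans (subset_insert x s), fun hV => hx (h hV)⟩,
      fun h => (Finset.subset_insert_iff_of_notMem h.2).1 h.1⟩
  have hblocks := sum_finpartition_sum_parts (s := insert x s) fun V P => if x ∈ V then 0 else
    a V.card * (partitionMoebius R P.card * ∏ W ∈ P, a W.card)
  simp only [sum_parts_notMem_eq a _ (mem_insert_self x s)] at hblocks
  rw [hblocks, hfilter, Finset.sum_filter]
  refine Finset.sum_congr rfl fun V _ => ?_
  split_ifs
  · exact Finset.sum_const_zero.symm
  · rw [cumulantSum, Finset.mul_sum]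

theorem sum_finpartition_card_sub_one_eq_zero (F : Finset (Finset α) → R) (hs : s.Nonempty) :
    ∑ π : Finpartition s, (if π.parts.card - 1 = 0 then 1 else 0) * F π.parts = F {s} := by
  rw [Finset.sum_eq_single (Finpartition.indiscrete hs.ne_empty)]
  · simp
  · intro π _ hπ
    rw [if_neg, zero_mul]
    intro hcard
    obtain ⟨V, hV⟩ : ∃ V, π.parts = {V} := Finset.card_eq_one.1 <| le_antisymm
      (Nat.sub_eq_zero_iff_le.1 hcard) (Finset.card_pos.2 (π.parts_nonempty hs.ne_empty))
    obtain rfl : V = s := by simpa [hV] using π.sup_parts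
    exact hπ (Finpartition.ext hV)
  · exact fun h => absurd (mem_univ _) h

theorem sum_powerset_mul_cumulantSum {a : ℕ → R} (h0 : a 0 = 1) {x : α} (hx : x ∉ s) :
    ∑ V ∈ s.powerset, a V.card * cumulantSum a (insert x s \ V) = a (s.card + 1) := by
  have hweight (π : Finpartition (insert x s)) : partitionMoebius R π.parts.card +
      ((π.parts.card - 1 : ℕ) : R) * partitionMoebius R (π.parts.card - 1) =
      if π.parts.card - 1 = 0 then 1 else 0 := by
    rw [← partitionMoebius_succ, Nat.sub_add_cancel (Finset.card_pos.2 <|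
      π.parts_nonempty (Finset.insert_ne_empty x s))]
  rw [← Finset.add_sum_erase _ _ (Finset.empty_mem_powerset s),
    sum_powerset_erase_mul_cumulantSum a hx, Finset.card_empty, h0, one_mul, Finset.sdiff_empty,
    cumulantSum, ← Finset.sum_add_distrib]
  simp only [← add_mul, hweight]
  rw [sum_finpartition_card_sub_one_eq_zero (fun P => ∏ V ∈ P, a V.card)
    (Finset.insert_nonempty x s), Finset.prod_singleton, Finset.card_insert_of_notMem hx]

theorem cumulantSum_insert {a c : ℕ → R} (h0 : a 0 = 1) {x : α} (hx : x ∉ s)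
    (hc : ∀ V ⊆ s, V.Nonempty → cumulantSum a (insert x s \ V) = c (s.card + 1 - V.card)) :
    cumulantSum a (insert x s) = a (s.card + 1) - ∑ k ∈ range s.card,
      (s.card.choose (k + 1) : R) * (a (k + 1) * c (s.card - k)) := by
  have hsum := Finset.sum_powerset_apply_card (x := s) fun k => a k * c (s.card + 1 - k)
  rw [← Finset.add_sum_erase _ _ (Finset.empty_mem_powerset s), Finset.sum_range_succ',
    Nat.choose_zero_right, one_smul, add_comm, Finset.card_empty, add_left_inj] at hsum
  simp only [nsmul_eq_mul, Nat.add_sub_add_right] at hsum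
  rw [← sum_powerset_mul_cumulantSum h0 hx, ← Finset.add_sum_erase _ _
    (Finset.empty_mem_powerset s), ← hsum, Finset.card_empty, h0, one_mul, Finset.sdiff_empty,
    eq_sub_iff_add_eq, add_right_inj]
  refine Finset.sum_congr rfl fun V hV => ?_
  rw [hc V (Finset.mem_powerset.1 (Finset.mem_of_mem_erase hV))
    (Finset.nonempty_iff_ne_empty.2 (Finset.ne_of_mem_erase hV))]

theorem cumulantSum_eq_univ {a : ℕ → R} (h0 : a 0 = 1) {n N : ℕ} {s : Finset (Fin N)}
    (hs : s.card = n + 1) : cumulantSum a s = cumulantSum a (univ : Finset (Fin (n + 1))) := by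
  induction n using Nat.strong_induction_on generalizing N with
  | _ n ih =>
    have hrec {M : ℕ} {t : Finset (Fin M)} (ht : t.card = n + 1) :
        cumulantSum a t = a (n + 1) - ∑ k ∈ range n, (n.choose (k + 1) : R) *
          (a (k + 1) * cumulantSum a (univ : Finset (Fin (n - k)))) := by
      obtain ⟨x, t, hx, rfl, rfl⟩ := Finset.card_eq_succ.1 ht
      refine cumulantSum_insert (c := fun m => cumulantSum a (univ : Finset (Fin m))) h0 hx
        fun V hV hVne => ?_
      have hVpos := hVne.card_pos
      have hVle := Finset.card_le_card hV
      have hcard : (insert x t \ V).card = t.card - V.card + 1 := by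
        rw [Finset.card_sdiff_of_subset (hV.trans (subset_insert x t)), ht]
        omega
      rw [ih _ (by omega) hcard, ← Nat.sub_add_comm hVle]
    rw [hrec hs, hrec (Finset.card_fin _)]

theorem isFormalExp_cumulantSum {a : ℕ → R} (h0 : a 0 = 1) :
    IsFormalExp a fun n => cumulantSum a (univ : Finset (Fin n)) where
  zero := h0
  succ n := by
    have hcard : (univ.erase (0 : Fin (n + 1))).card = n := by
      rw [card_erase_of_mem (mem_univ _), card_univ, Fintype.card_fin, Nat.add_sub_cancel]
    have hsum := Finset.sum_powerset_apply_card (x := univ.erase (0 : Fin (n + 1)))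
      fun k => a k * cumulantSum a (univ : Finset (Fin (n - k + 1)))
    rw [hcard] at hsum
    simp only [nsmul_eq_mul] at hsum
    have hterm (V) (hV : V ∈ (univ.erase (0 : Fin (n + 1))).powerset) :
        cumulantSum a (insert 0 (univ.erase 0) \ V) =
          cumulantSum a (univ : Finset (Fin (n - V.card + 1))) := by
      have hVle := Finset.card_le_card (Finset.mem_powerset.1 hV)
      refine cumulantSum_eq_univ h0 ?_
      rw [Finset.insert_erase (mem_univ _), Finset.card_univ_sdiff, Fintype.card_fin]
      omega
    rw [← hcard, ← sum_powerset_mul_cumulantSum h0 (notMem_erase 0 univ), hcard,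
      Finset.sum_congr rfl fun V hV => by rw [hterm V hV], hsum, ← Finset.sum_range_reflect]
    refine Finset.sum_congr rfl fun k hk => ?_
    have hkn : k ≤ n := Nat.lt_succ_iff.1 (mem_range.1 hk)
    rw [Nat.add_sub_cancel, Nat.choose_symm hkn, Nat.sub_sub_self hkn, mul_comm (a _)]

end SetPartitions

/-! ### Counting permutations -/

section Counting

theorem eq_filter_add_replicate_one {m : Multiset ℕ} (hpos : ∀ k ∈ m, 1 ≤ k) :
    m = m.filter (2 ≤ ·) + Multiset.replicate (m.count 1) 1 := by
  have hones : m.filter (fun k => ¬2 ≤ k) = Multiset.replicate (m.count 1) 1 := by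
    rw [← Multiset.filter_eq']
    refine Multiset.filter_congr fun k hk => ?_
    have := hpos k hk
    omega
  rw [← hones, Multiset.filter_add_not]

theorem prod_count_factorial_eq {m : Multiset ℕ} (hpos : ∀ k ∈ m, 1 ≤ k) :
    ∏ k ∈ m.toFinset, (m.count k).factorial = (m.count 1).factorial *
      ∏ k ∈ (m.filter (2 ≤ ·)).toFinset, ((m.filter (2 ≤ ·)).count k).factorial := by
  have hnot : 1 ∉ (m.filter (2 ≤ ·)).toFinset := by simp
  have hsub : m.toFinset ⊆ insert 1 (m.filter (2 ≤ ·)).toFinset := fun k hk => by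
    have := hpos k (Multiset.mem_toFinset.1 hk)
    rw [mem_insert, Multiset.toFinset_filter, mem_filter]
    exact (eq_or_lt_of_le this).imp Eq.symm fun h => ⟨hk, h⟩
  rw [Finset.prod_subset hsub fun k _ hk => by
    rw [Multiset.count_eq_zero.2 (mt Multiset.mem_toFinset.2 hk), Nat.factorial_zero],
    Finset.prod_insert hnot]
  congr 1
  refine Finset.prod_congr rfl fun k hk => ?_
  rw [Multiset.count_filter_of_pos (Multiset.mem_filter.1 (Multiset.mem_toFinset.1 hk)).2]

variable {α : Type*} [Fintype α] [DecidableEq α]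

theorem partition_parts_eq_iff_cycleType_eq {m : Multiset ℕ} (hsum : m.sum = Fintype.card α)
    (hpos : ∀ k ∈ m, 1 ≤ k) {σ : Perm α} :
    σ.partition.parts = m ↔ σ.cycleType = m.filter (2 ≤ ·) := by
  refine ⟨fun h => by rw [← h, Perm.filter_parts_partition_eq_cycleType], fun h => ?_⟩
  have hm := eq_filter_add_replicate_one hpos
  have hcard : (m.filter (2 ≤ ·)).sum + m.count 1 = Fintype.card α := by
    rw [← hsum]
    conv_rhs => rw [hm]
    simp
  rw [Perm.parts_partition, ← Perm.sum_cycleType, h, ← hcard, Nat.add_sub_cancel_left]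
  exact hm.symm

theorem card_partition_parts_eq_mul {m : Multiset ℕ} (hsum : m.sum = Fintype.card α)
    (hpos : ∀ k ∈ m, 1 ≤ k) :
    (univ.filter fun σ : Perm α => σ.partition.parts = m).card *
      (m.prod * ∏ k ∈ m.toFinset, (m.count k).factorial) = (Fintype.card α).factorial := by
  have hm := eq_filter_add_replicate_one hpos
  have hprod : m.prod = (m.filter (2 ≤ ·)).prod := by
    conv_lhs => rw [hm]
    simp
  have hcard : (m.filter (2 ≤ ·)).sum + m.count 1 = Fintype.card α := by
    rw [← hsum]
    conv_rhs => rw [hm]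
    simp
  have hcycleType := Perm.card_of_cycleType_mul_eq α (m.filter (2 ≤ ·))
  rw [if_pos ⟨by omega, fun k hk => (Multiset.mem_filter.1 hk).2⟩, ← hcard,
    Nat.add_sub_cancel_left, hcard] at hcycleType
  simp only [partition_parts_eq_iff_cycleType_eq hsum hpos]
  rw [prod_count_factorial_eq hpos, hprod, ← hcycleType]
  ring

theorem cycleCount_eq_one_iff {σ : Perm α} :
    cycleCount σ = 1 ↔ σ.partition.parts = {Fintype.card α} := by
  refine ⟨fun h => ?_, fun h => by rw [cycleCount, h, Multiset.card_singleton]⟩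
  obtain ⟨k, hk⟩ := Multiset.card_eq_one.1 h
  rw [hk, ← σ.partition.parts_sum, hk, Multiset.sum_singleton]

theorem card_cycleCount_eq_one (n : ℕ) :
    (univ.filter fun σ : Perm (Fin (n + 1)) => cycleCount σ = 1).card = n.factorial := by
  have hcard := card_partition_parts_eq_mul (α := Fin (n + 1)) (m := {n + 1}) (by simp) (by simp)
  simp only [Multiset.prod_singleton, Multiset.toFinset_singleton, Finset.prod_singleton,
    Multiset.count_singleton_self, Nat.factorial_one, mul_one, Fintype.card_fin] at hcard
  simp only [cycleCount_eq_one_iff, Fintype.card_fin]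
  rw [Nat.factorial_succ, mul_comm (n + 1)] at hcard
  exact Nat.eq_of_mul_eq_mul_right n.succ_pos hcard

theorem jointlyTransitive_of_cycleCount_eq_one {σ : Perm α} (τ : Perm α)
    (h : cycleCount σ = 1) : JointlyTransitive σ τ := by
  obtain ⟨V, hV⟩ := Finset.card_eq_one.1 ((cycleCount_eq_card_parts σ).symm.trans h)
  have hpart (a : α) : (cyclePartition σ).part a = V := by
    rw [← Finset.mem_singleton, ← hV]
    exact (cyclePartition σ).part_mem.2 (mem_univ a)
  refine ⟨fun a b => ?_⟩
  obtain ⟨k, hk⟩ : σ.SameCycle a b := by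
    rw [← mem_part_cyclePartition, mem_part_iff_part_eq, hpart, hpart]
  exact ⟨⟨σ ^ k, Subgroup.zpow_mem _ (Subgroup.subset_closure (Set.mem_insert _ _)) k⟩, hk⟩

theorem jointlyTransitive_one_iff [Nonempty α] {σ : Perm α} :
    JointlyTransitive σ 1 ↔ cycleCount σ = 1 := by
  refine ⟨fun h => ?_, jointlyTransitive_of_cycleCount_eq_one 1⟩
  have hle := cycleCount_add_le h
  have hpos := cycleCount_pos σ
  rw [cycleCount_one] at hle
  omega

variable {R : Type*} [CommSemiring R]

theorem cycleWeight_of_cycleCount_eq_one (x : ℕ → R) {σ : Perm α} (h : cycleCount σ = 1) :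
    cycleWeight x σ = x (Fintype.card α) := by
  rw [cycleWeight, cycleCount_eq_one_iff.1 h, Multiset.map_singleton, Multiset.prod_singleton]

theorem cycleWeight_indicator (σ : Perm α) :
    cycleWeight (fun j => if j = 1 then (1 : R) else 0) σ = if σ = 1 then 1 else 0 := by
  split_ifs with h
  · simp [h, cycleWeight, Perm.parts_partition]
  · obtain ⟨k, hk⟩ := Multiset.exists_mem_of_ne_zero (mt Perm.cycleType_eq_zero.1 h)
    refine Multiset.prod_eq_zero (Multiset.mem_map.2 ⟨k, ?_, ?_⟩)
    · rw [Perm.parts_partition]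
      exact Multiset.mem_add.2 (Or.inl hk)
    · exact if_neg (Perm.one_lt_of_mem_cycleType hk).ne'

/-- The sum of `x_σ` over all permutations of `n` points. -/
def permSum (n : ℕ) (x : ℕ → R) : R := ∑ σ : Perm (Fin n), cycleWeight x σ

theorem totalPairSum_eq_mul (n : ℕ) (x y : ℕ → R) :
    totalPairSum (Fin n) x y = permSum n x * permSum n y := by
  rw [totalPairSum, permSum, permSum, Finset.sum_mul_sum, Fintype.sum_prod_type]

theorem permSum_indicator (n : ℕ) : permSum n (fun j => if j = 1 then (1 : R) else 0) = 1 := by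
  simp only [permSum, cycleWeight_indicator, Finset.sum_ite_eq', mem_univ, if_true]

theorem transitivePairSum_indicator (n : ℕ) (x : ℕ → R) :
    transitivePairSum (Fin (n + 1)) x (fun j => if j = 1 then 1 else 0) =
      (n.factorial : R) * x (n + 1) := by
  classical
  have hinner (σ : Perm (Fin (n + 1))) : (∑ τ : Perm (Fin (n + 1)),
      if JointlyTransitive σ τ then
        cycleWeight x σ * cycleWeight (fun j => if j = 1 then 1 else 0) τ else 0) =
      if cycleCount σ = 1 then x (n + 1) else 0 := by
    simp only [cycleWeight_indicator, mul_ite, mul_one, mul_zero]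
    rw [Finset.sum_eq_single 1 (fun τ _ hτ => by rw [if_neg hτ, ite_self])
      fun h => absurd (mem_univ _) h, if_pos rfl]
    simp only [jointlyTransitive_one_iff]
    refine if_ctx_congr Iff.rfl (fun hσ => ?_) fun _ => rfl
    rw [cycleWeight_of_cycleCount_eq_one x hσ, Fintype.card_fin]
  rw [transitivePairSum, Finset.sum_filter, Fintype.sum_prod_type, Finset.sum_congr rfl fun σ _ =>
    hinner σ, ← Finset.sum_filter, Finset.sum_const, card_cycleCount_eq_one, nsmul_eq_mul]

/-- The exponential formula: `(n - 1)!` counts the cycles through all of `n` points. -/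
theorem isFormalExp_permSum (x : ℕ → R) :
    IsFormalExp (fun n => permSum n x) fun n => ((n - 1).factorial : R) * x n where
  zero := by
    simpa only [totalPairSum_eq_mul, permSum_indicator, mul_one] using
      (isFormalExp_totalPairSum x fun j => if j = 1 then (1 : R) else 0).zero
  succ n := by
    simpa only [totalPairSum_eq_mul, permSum_indicator, mul_one, transitivePairSum_indicator,
      Nat.add_sub_cancel] using
      (isFormalExp_totalPairSum x fun j => if j = 1 then (1 : R) else 0).succ n

end Counting

/-! ### Moments as a genus expansion -/

section ExactFormula

section Newton

variable {R : Type*} [CommRing R]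

theorem mul_esymm_succ_eq_sum (s : Multiset R) (n : ℕ) :
    ((n : R) + 1) * s.esymm (n + 1) = ∑ k ∈ range (n + 1),
      (-1) ^ k * s.esymm (n - k) * (s.map fun x => x ^ (k + 1)).sum := by
  obtain ⟨l, rfl⟩ : ∃ l : List R, (l : Multiset R) = s := Quot.exists_rep s
  have hl : (l : Multiset R) = (univ : Finset (Fin l.length)).val.map l.get := by
    simp only [Fin.univ_val_map, List.ofFn_get]
  have hnewton := congrArg (MvPolynomial.aeval (R := R) l.get)
    (MvPolynomial.mul_esymm_eq_sum (Fin l.length) R (n + 1))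
  simp only [map_mul, map_pow, map_neg, map_one, map_natCast, MvPolynomial.psum, map_sum,
    MvPolynomial.aeval_X, MvPolynomial.aeval_esymm_eq_multiset_esymm, ← hl] at hnewton
  rw [Finset.sum_filter, Finset.Nat.sum_antidiagonal_eq_sum_range_succ_mk,
    Finset.sum_range_succ] at hnewton
  simp only [lt_self_iff_false, if_false, add_zero, Nat.cast_add, Nat.cast_one] at hnewton
  rw [hnewton, ← Finset.sum_range_reflect, Finset.mul_sum]
  refine Finset.sum_congr rfl fun k hk => ?_
  have hkn : k ≤ n := Nat.lt_succ_iff.1 (Finset.mem_range.1 hk)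
  have hsum : ((l : Multiset R).map fun x => x ^ (k + 1)).sum =
      ∑ i, l.get i ^ (k + 1) := by
    rw [hl, Multiset.map_map]
    rfl
  have hsign : ((-1 : R)) ^ (n + 1 + 1) * (-1) ^ (n - k) = (-1) ^ k := by
    rw [← pow_add, show n + 1 + 1 + (n - k) = k + 2 * (n - k + 1) by omega, pow_add, pow_mul,
      neg_one_sq, one_pow, mul_one]
  rw [if_pos (by omega), hsum, show n + 1 - 1 - k = n - k by omega,
    show n + 1 - (n - k) = k + 1 by omega, ← hsign]
  ring

theorem isFormalExp_esymm (s : Multiset R) :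
    IsFormalExp (fun n => (n.factorial : R) * s.esymm n)
      fun n => ((n - 1).factorial : R) * ((-1) ^ (n - 1) * (s.map fun x => x ^ n).sum) where
  zero := by simp [Multiset.esymm]
  succ n := by
    rw [Nat.factorial_succ, Nat.cast_mul, Nat.cast_succ, mul_right_comm, mul_esymm_succ_eq_sum,
      Finset.sum_mul]
    refine Finset.sum_congr rfl fun k hk => ?_
    rw [← Nat.choose_mul_factorial_mul_factorial (Nat.lt_succ_iff.1 (mem_range.1 hk)),
      Nat.add_sub_cancel]
    push_cast
    ring

theorem esymm_replicate_one (d n : ℕ) :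
    (Multiset.replicate d (1 : R)).esymm n = (d.choose n : R) := by
  rw [Multiset.esymm, Multiset.map_congr (g := fun _ => 1) rfl fun t ht => Multiset.prod_eq_one
    fun x hx => Multiset.eq_of_mem_replicate
      (Multiset.mem_of_le (Multiset.mem_powersetCard.1 ht).1 hx), Multiset.map_const',
    Multiset.sum_replicate, Multiset.card_powersetCard, Multiset.card_replicate, nsmul_one]

theorem permSum_eq_descFactorial (d n : ℕ) :
    permSum n (fun j => (-1) ^ (j - 1) * (d : R)) = (d.descFactorial n : R) := by
  have hesymm := isFormalExp_esymm (Multiset.replicate d (1 : R))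
  simp only [Multiset.map_replicate, one_pow, Multiset.sum_replicate, nsmul_one] at hesymm
  rw [congrFun ((isFormalExp_permSum _).left_unique hesymm) n, esymm_replicate_one,
    Nat.descFactorial_eq_factorial_mul_choose, Nat.cast_mul]

end Newton

section PowerSums

variable {d : ℕ} {p : Polynomial ℝ}

/-- The weight of a cycle of length `j`, for which the normalized coefficient `aₙ` of `p` is the sum
of the weights of all permutations of `n` points. -/
def coeffWeight (p : Polynomial ℝ) (j : ℕ) : ℝ :=
  cumulantSum (normCoeff p) (univ : Finset (Fin j)) / ((j - 1).factorial : ℝ)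

theorem normCoeff_zero (hp : p.Monic) : normCoeff p 0 = 1 := by
  simp [normCoeff, hp.coeff_natDegree]

theorem normCoeff_eq_permSum (hp : p.Monic) (n : ℕ) :
    normCoeff p n = permSum n (coeffWeight p) := by
  have hperm := isFormalExp_permSum (coeffWeight p)
  have hcancel (j : ℕ) : ((j - 1).factorial : ℝ) * coeffWeight p j =
      cumulantSum (normCoeff p) (univ : Finset (Fin j)) := mul_div_cancel₀ _ (by positivity)
  simp only [hcancel] at hperm
  exact congrFun ((isFormalExp_cumulantSum (normCoeff_zero hp)).left_unique hperm) n

theorem normCoeff_mul_descFactorial (hp : IsMonicRealRooted d p) (n : ℕ) :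
    normCoeff p n * d.descFactorial n = n.factorial * p.roots.esymm n := by
  obtain ⟨hmonic, hdeg, hsplit⟩ := hp
  rcases lt_or_ge d n with hn | hn
  · have hcard : p.roots.card < n := (p.card_roots'.trans hdeg.le).trans_lt hn
    rw [Nat.descFactorial_eq_zero_iff_lt.2 hn, Multiset.esymm,
      Multiset.powersetCard_eq_empty _ hcard]
    simp
  · have hchoose : (d.choose n : ℝ) ≠ 0 := by exact_mod_cast (Nat.choose_pos hn).ne'
    have hsign : ((-1 : ℝ) ^ n) * (-1) ^ n = 1 := by rw [← mul_pow, neg_one_mul, neg_neg, one_pow]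
    rw [normCoeff, Polynomial.coeff_eq_esymm_roots_of_splits hsplit (Nat.sub_le _ _), hdeg,
      hmonic.leadingCoeff, Nat.sub_sub_self hn, Nat.descFactorial_eq_factorial_mul_choose,
      Nat.cast_mul]
    field_simp
    linear_combination p.roots.esymm n * hsign

theorem transitivePairSum_eq_sum_roots_pow (hp : IsMonicRealRooted d p) (n : ℕ) :
    transitivePairSum (Fin (n + 1)) (coeffWeight p) (fun j => (-1) ^ (j - 1) * (d : ℝ)) =
      n.factorial * ((-1) ^ n * (p.roots.map fun x => x ^ (n + 1)).sum) := by
  have htotal := isFormalExp_totalPairSum (coeffWeight p) fun j => (-1) ^ (j - 1) * (d : ℝ)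
  simp only [totalPairSum_eq_mul, permSum_eq_descFactorial, ← normCoeff_eq_permSum hp.1,
    normCoeff_mul_descFactorial hp] at htotal
  exact htotal.right_unique (isFormalExp_esymm p.roots) n

end PowerSums

section CycleWeight

variable {α M : Type*} [Fintype α] [DecidableEq α] [CommMonoid M]

theorem cycleWeight_mul (u v : ℕ → M) (σ : Perm α) :
    cycleWeight (fun j => u j * v j) σ = cycleWeight u σ * cycleWeight v σ := by
  simp only [cycleWeight_eq_prod, Finset.prod_mul_distrib]

theorem cycleWeight_pow_pred (c : M) (σ : Perm α) :
    cycleWeight (fun j => c ^ (j - 1)) σ = c ^ (Fintype.card α - cycleCount σ) := by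
  have hcard := (cyclePartition σ).sum_card_parts
  rw [Finset.card_univ] at hcard
  rw [cycleWeight_eq_prod, Finset.prod_pow_eq_pow_sum, cycleCount_eq_card_parts, ← hcard,
    Finset.sum_tsub_distrib _ fun V hV =>
      Finset.card_pos.2 ((cyclePartition σ).nonempty_of_mem_parts hV),
    Finset.sum_const, smul_eq_mul, mul_one]

theorem cycleWeight_const (c : M) (σ : Perm α) :
    cycleWeight (fun _ => c) σ = c ^ cycleCount σ := by
  rw [cycleWeight_eq_prod, Finset.prod_const, cycleCount_eq_card_parts]

end CycleWeight

open Classical in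
/-- The polynomial in `u` and `ε` whose value at the finite free cumulants of a polynomial of degree
`d` and `ε = 1 / d` is its moment of order `n + 1`. The exponent is the truncated subtraction
`n + 2 - (|σ| + |τ|)`, which is exact on transitive pairs. -/
def genusExpansion (n : ℕ) (u : ℕ → ℝ) (ε : ℝ) : ℝ :=
  1 / (n.factorial : ℝ) * ∑ p : Perm (Fin (n + 1)) × Perm (Fin (n + 1)) with
    JointlyTransitive p.1 p.2,
      cycleWeight u p.1 * (-ε) ^ (n + 2 - (cycleCount p.1 + cycleCount p.2))

theorem neg_one_pow_mul_neg_pow {K : Type*} [Field K] {ε : K} (hε : ε ≠ 0) {n s t : ℕ}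
    (hs : 0 < s) (ht : 0 < t) (hst : s + t ≤ n + 2) :
    (-1) ^ n * ε * ((-ε) ^ (n + 1 - s) * ((-1) ^ (n + 1 - t) * ε⁻¹ ^ t)) =
      (-ε) ^ (n + 2 - (s + t)) := by
  obtain ⟨s, rfl⟩ := Nat.exists_eq_add_one.2 hs
  obtain ⟨t, rfl⟩ := Nat.exists_eq_add_one.2 ht
  obtain ⟨r, rfl⟩ := Nat.exists_eq_add_of_le (show s + t ≤ n by omega)
  have hsign : (-1 : K) ^ (s + t + r) * (-1) ^ (t + r) * (-1) ^ (s + r) = (-1) ^ r := by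
    rw [← pow_add, ← pow_add, show s + t + r + (t + r) + (s + r) = 2 * (s + t + r) + r by omega,
      pow_add, pow_mul, neg_one_sq, one_pow, one_mul]
  have hcancel : ε * ε ^ (t + r) * ε⁻¹ ^ (t + 1) = ε ^ r := by
    rw [← pow_succ', show t + r + 1 = r + (t + 1) by omega, pow_add, inv_pow,
      mul_inv_cancel_right₀ (pow_ne_zero _ hε)]
  rw [show s + t + r + 1 - (s + 1) = t + r by omega, show s + t + r + 1 - (t + 1) = s + r by omega,
    show s + t + r + 2 - (s + 1 + (t + 1)) = r by omega, neg_pow ε, neg_pow ε r, ← hsign]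
  linear_combination (-1) ^ (s + t + r) * (-1) ^ (t + r) * (-1) ^ (s + r) * hcancel

variable {d : ℕ} {p : Polynomial ℝ}

theorem coeffWeight_eq (hd : 1 ≤ d) (hp : p.natDegree = d) :
    coeffWeight p = fun j => finiteFreeCumulant p j * (-(1 / (d : ℝ))) ^ (j - 1) := by
  funext j
  have hd0 : (d : ℝ) ≠ 0 := by positivity
  have hpow : (-(d : ℝ)) ^ (j - 1) * (-(1 / (d : ℝ))) ^ (j - 1) = 1 := by
    rw [← mul_pow, neg_mul_neg, mul_one_div_cancel hd0, one_pow]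
  have hcumulant : finiteFreeCumulant p j = (-(d : ℝ)) ^ (j - 1) * coeffWeight p j := by
    rw [← hp, coeffWeight, ← mul_div_assoc, mul_div_right_comm]
    rfl
  rw [hcumulant, mul_right_comm, hpow, one_mul]

theorem rootMoment_eq_genusExpansion (hd : 1 ≤ d) (hp : IsMonicRealRooted d p) (n : ℕ) :
    rootMoment p (n + 1) = genusExpansion n (finiteFreeCumulant p) (1 / (d : ℝ)) := by
  classical
  have hd0 : (d : ℝ) ≠ 0 := by positivity
  have hmoment : rootMoment p (n + 1) = 1 / (n.factorial : ℝ) * ((-1) ^ n * (1 / (d : ℝ)) *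
      transitivePairSum (Fin (n + 1)) (coeffWeight p) (fun j => (-1) ^ (j - 1) * (d : ℝ))) := by
    have hsign : ((-1 : ℝ) ^ n) * (-1) ^ n = 1 := by rw [← mul_pow, neg_one_mul, neg_neg, one_pow]
    rw [transitivePairSum_eq_sum_roots_pow hp n, rootMoment, hp.2.1]
    field_simp
    linear_combination (-(Multiset.map (fun x => x ^ (n + 1)) p.roots).sum) * hsign
  rw [hmoment, genusExpansion, transitivePairSum, Finset.mul_sum]
  congr 1
  refine Finset.sum_congr rfl fun q hq => ?_
  have hle := cycleCount_add_le (Finset.mem_filter.1 hq).2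
  have hpow := neg_one_pow_mul_neg_pow (one_div_ne_zero hd0) (cycleCount_pos q.1)
    (cycleCount_pos q.2) (hle.trans_eq (by rw [Fintype.card_fin]))
  rw [coeffWeight_eq hd hp.2.1, cycleWeight_mul, cycleWeight_pow_pred, cycleWeight_mul,
    cycleWeight_pow_pred, cycleWeight_const, Fintype.card_fin, ← hpow, one_div, inv_inv]
  ring

end ExactFormula

/-! ### The terms of genus zero and of annular type -/

section RelativeSums

variable {α β R : Type*} [Fintype α] [DecidableEq α] [Fintype β] [DecidableEq β] [CommSemiring R]

open Classical in
/-- The sum of the cycle weights of the permutations `σ` that act transitively together with `γ` and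
satisfy `|σ| + |σ⁻¹ γ| = c`; for `γ` an annular rotation of `N` points and `c = N` it runs over the
annular non-crossing permutations. -/
def relativeSum (u : ℕ → R) (c : ℕ) (γ : Perm α) : R :=
  ∑ σ : Perm α with JointlyTransitive σ γ ∧ cycleCount σ + cycleCount (σ⁻¹ * γ) = c,
    cycleWeight u σ

theorem jointlyTransitive_mul_iff {α : Type*} {σ τ : Perm α} :
    JointlyTransitive σ (σ * τ) ↔ JointlyTransitive σ τ := by
  have left_mem (ρ : Perm α) : σ ∈ Subgroup.closure {σ, ρ} := Subgroup.subset_closure (by simp)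
  have right_mem (ρ : Perm α) : ρ ∈ Subgroup.closure {σ, ρ} := Subgroup.subset_closure (by simp)
  have hclosure : Subgroup.closure {σ, σ * τ} = Subgroup.closure {σ, τ} := by
    refine le_antisymm ?_ ?_ <;> rw [Subgroup.closure_le, Set.insert_subset_iff,
      Set.singleton_subset_iff]
    · exact ⟨left_mem τ, mul_mem (left_mem τ) (right_mem τ)⟩
    · exact ⟨left_mem _, (Subgroup.mul_mem_cancel_left _ (left_mem _)).1 (right_mem _)⟩
  rw [JointlyTransitive, JointlyTransitive, hclosure]

open Classical in
theorem sum_pairs_eq_sum_relativeSum (u : ℕ → R) (c : ℕ) :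
    (∑ p : Perm α × Perm α with
      JointlyTransitive p.1 p.2 ∧ cycleCount p.1 + cycleCount p.2 = c, cycleWeight u p.1) =
      ∑ γ : Perm α, relativeSum u c γ := by
  simp only [relativeSum, Finset.sum_filter]
  rw [Fintype.sum_prod_type]
  conv_rhs => rw [Finset.sum_comm]
  refine Finset.sum_congr rfl fun σ _ => Fintype.sum_equiv (Equiv.mulLeft σ) _ _ fun τ => ?_
  simp only [Equiv.coe_mulLeft, inv_mul_cancel_left, jointlyTransitive_mul_iff]

theorem relativeSum_permCongr (u : ℕ → R) (c : ℕ) (e : α ≃ β) (γ : Perm α) :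
    relativeSum u c (e.permCongr γ) = relativeSum u c γ := by
  classical
  refine (Finset.sum_equiv e.permCongr (fun σ => ?_)
    fun σ _ => (cycleWeight_permCongr u e σ).symm).symm
  have hquotient : (e.permCongr σ)⁻¹ * e.permCongr γ = e.permCongr (σ⁻¹ * γ) := by
    exact ((map_mul e.permCongrHom _ _).trans (by rw [map_inv]; rfl)).symm
  simp only [mem_filter_univ, hquotient, jointlyTransitive_permCongr_iff, cycleCount_permCongr]

theorem relativeSum_congr (u : ℕ → R) (c : ℕ) {γ γ' : Perm α}
    (h : γ.partition.parts = γ'.partition.parts) : relativeSum u c γ = relativeSum u c γ' := by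
  obtain ⟨g, rfl⟩ := isConj_iff.1 (Perm.partition_eq_of_isConj.2 (Nat.Partition.ext h))
  rw [← permCongr_eq_mul, relativeSum_permCongr]

theorem relativeSum_eq_zero (u : ℕ → R) {c : ℕ} {γ : Perm α}
    (h : ∀ σ τ : Perm α, JointlyTransitive σ τ → cycleCount σ + cycleCount τ = c → σ * τ ≠ γ) :
    relativeSum u c γ = 0 := by
  classical
  rw [relativeSum, Finset.filter_false_of_mem, Finset.sum_empty]
  rintro σ - ⟨htrans, hcount⟩
  refine h σ (σ⁻¹ * γ) ?_ hcount (mul_inv_cancel_left _ _)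
  rwa [← jointlyTransitive_mul_iff, mul_inv_cancel_left]

theorem relativeSum_finRotate (u : ℕ → ℝ) (n : ℕ) :
    relativeSum u (n + 2) (finRotate (n + 1)) = ∑ π ∈ NC (n + 1), blockProd u π := by
  classical
  rw [← sum_genus_zero_eq_sum_NC]
  refine Finset.sum_congr (Finset.filter_congr fun σ _ => and_iff_right ?_) fun _ _ => rfl
  rw [← mul_inv_cancel_left σ (finRotate (n + 1)), jointlyTransitive_mul_iff]
  exact jointlyTransitive_of_mul_eq_finRotate (mul_inv_cancel_left σ _)

theorem partition_parts_finRotate (n : ℕ) :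
    (finRotate (n + 1)).partition.parts = {n + 1} := by
  rw [cycleCount_eq_one_iff.1 (cycleCount_finRotate n), Fintype.card_fin]

theorem sum_relativeSum_genus_zero (u : ℕ → ℝ) (n : ℕ) :
    ∑ γ : Perm (Fin (n + 1)), relativeSum u (n + 2) γ =
      n.factorial * ∑ π ∈ NC (n + 1), blockProd u π := by
  have hcycle (γ : Perm (Fin (n + 1))) (hγ : relativeSum u (n + 2) γ ≠ 0) : cycleCount γ = 1 := by
    contrapose! hγ
    refine relativeSum_eq_zero u fun σ τ htrans hcount hmul => hγ ?_
    rw [← hmul]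
    exact cycleCount_mul_eq_one htrans (by rw [hcount, Fintype.card_fin])
  rw [← Finset.sum_filter_of_ne fun γ _ => hcycle γ, ← card_cycleCount_eq_one, ← nsmul_eq_mul]
  refine Finset.sum_eq_card_nsmul fun γ hγ => ?_
  rw [← relativeSum_finRotate]
  refine relativeSum_congr u _ ?_
  rw [partition_parts_finRotate, cycleCount_eq_one_iff.1 (Finset.mem_filter.1 hγ).2,
    Fintype.card_fin]

theorem partition_parts_sumCongr (σ : Perm α) (τ : Perm β) :
    (Perm.sumCongr σ τ).partition.parts = σ.partition.parts + τ.partition.parts := by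
  let onLeft : α ⊕ β → Prop := fun x => x.isLeft
  let eLeft : α ≃ {x // onLeft x} :=
    ⟨fun a => ⟨Sum.inl a, rfl⟩, fun x => x.1.getLeft x.2, fun _ => rfl, fun x => by simp⟩
  let eRight : β ≃ {x // ¬onLeft x} :=
    ⟨fun b => ⟨Sum.inr b, by simp [onLeft]⟩, fun x => x.1.getRight (by simpa [onLeft] using x.2),
      fun _ => rfl, fun x => by simp⟩
  have hglue : Perm.sumCongr σ τ =
      Perm.subtypeCongr (eLeft.permCongr σ) (eRight.permCongr τ) := by
    ext x
    rcases x with a | b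
    · rw [Perm.subtypeCongr.left_apply _ _ (show onLeft (Sum.inl a) from rfl)]
      rfl
    · rw [Perm.subtypeCongr.right_apply _ _ (show ¬onLeft (Sum.inr b) by simp [onLeft])]
      rfl
  rw [hglue, partition_parts_subtypeCongr, partition_parts_permCongr, partition_parts_permCongr]

theorem partition_parts_annularRotation {t s : ℕ} (ht : 1 ≤ t) (hs : 1 ≤ s) :
    (annularRotation t s).partition.parts = {t, s} := by
  obtain ⟨t, rfl⟩ := Nat.exists_eq_add_one.2 ht
  obtain ⟨s, rfl⟩ := Nat.exists_eq_add_one.2 hs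
  rw [annularRotation, partition_parts_permCongr, partition_parts_sumCongr,
    partition_parts_finRotate, partition_parts_finRotate]
  rfl

theorem relativeSum_annularRotation (u : ℕ → ℝ) (t s : ℕ) :
    relativeSum u (t + s) (annularRotation t s) = ∑ σ ∈ annularNC t s, cycleProd u σ := by
  classical
  exact Finset.sum_congr (by ext; simp only [annularNC, mem_filter_univ]; rfl) fun _ _ => rfl

end RelativeSums

section TwoCycles

theorem multiset_pair_eq_pair_iff {α : Type*} {a b t s : α} :
    ({a, b} : Multiset α) = {t, s} ↔ a = t ∧ b = s ∨ a = s ∧ b = t := by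
  refine ⟨fun h => ?_, ?_⟩
  · rcases Multiset.cons_eq_cons.1 h with ⟨rfl, hb⟩ | ⟨-, v, hb, hs⟩
    · exact Or.inl ⟨rfl, Multiset.singleton_inj.1 hb⟩
    · obtain rfl : v = 0 := by simpa using congrArg Multiset.card hb
      exact Or.inr ⟨(Multiset.singleton_inj.1 hs).symm, Multiset.singleton_inj.1 hb⟩
  · rintro (⟨rfl, rfl⟩ | ⟨rfl, rfl⟩)
    exacts [rfl, Multiset.pair_comm _ _]

theorem sum_antidiagonal_pair_eq {N : ℕ} {P : Multiset ℕ} (hcard : P.card = 2) (hsum : P.sum = N)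
    (hpos : ∀ k ∈ P, 1 ≤ k) :
    ∑ ts ∈ antidiagonal N with (1 ≤ ts.1 ∧ 1 ≤ ts.2) ∧ P = {ts.1, ts.2},
      (if ts.1 = ts.2 then (2 : ℝ) else 1) = 2 := by
  obtain ⟨a, b, rfl⟩ := Multiset.card_eq_two.1 hcard
  obtain rfl : a + b = N := by simpa using hsum
  have ha : 1 ≤ a := hpos a (by simp)
  have hb : 1 ≤ b := hpos b (by simp)
  have hpairs : ((antidiagonal (a + b)).filter fun ts : ℕ × ℕ =>
      (1 ≤ ts.1 ∧ 1 ≤ ts.2) ∧ ({a, b} : Multiset ℕ) = {ts.1, ts.2}) = {(a, b), (b, a)} := by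
    ext ⟨t, s⟩
    simp only [mem_filter, HasAntidiagonal.mem_antidiagonal, multiset_pair_eq_pair_iff, mem_insert,
      mem_singleton, Prod.mk.injEq]
    omega
  rw [hpairs]
  by_cases hab : a = b
  · simp [hab]
  · rw [Finset.sum_pair fun h => hab (Prod.ext_iff.1 h).1, if_neg hab, if_neg (Ne.symm hab)]
    norm_num

theorem card_partition_parts_eq_pair {α : Type*} [Fintype α] [DecidableEq α] {t s : ℕ}
    (hN : t + s = Fintype.card α) (ht : 1 ≤ t) (hs : 1 ≤ s) :
    ((univ.filter fun γ : Perm α => γ.partition.parts = {t, s}).card : ℝ) *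
      (if t = s then 2 else 1) = (Fintype.card α).factorial / ((t : ℝ) * s) := by
  have hclass := card_partition_parts_eq_mul (α := α) (m := {t, s}) (by simpa using hN)
    (by simp [ht, hs])
  have hmultiplicity : ∏ k ∈ ({t, s} : Multiset ℕ).toFinset,
      (({t, s} : Multiset ℕ).count k).factorial = if t = s then 2 else 1 := by
    split_ifs with hts
    · simp [hts]
    · rw [show ({t, s} : Multiset ℕ).toFinset = {t, s} by ext; simp, Finset.prod_pair hts]
      simp [hts, Ne.symm hts]
  rw [hmultiplicity, Multiset.prod_pair] at hclass
  rw [eq_div_iff (by positivity), ← hclass]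
  push_cast
  ring

theorem sum_cycleCount_eq_two {α : Type*} [Fintype α] [DecidableEq α] (f : Multiset ℕ → ℝ) :
    ∑ γ : Perm α with cycleCount γ = 2, f γ.partition.parts =
      (Fintype.card α).factorial / 2 *
        ∑ ts ∈ antidiagonal (Fintype.card α) with 1 ≤ ts.1 ∧ 1 ≤ ts.2,
          f {ts.1, ts.2} / ((ts.1 : ℝ) * ts.2) := by
  let w (ts : ℕ × ℕ) : ℝ := if ts.1 = ts.2 then 2 else 1
  have hsplit (γ : Perm α) (hγ : cycleCount γ = 2) : f γ.partition.parts =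
      1 / 2 * ∑ ts ∈ antidiagonal (Fintype.card α) with 1 ≤ ts.1 ∧ 1 ≤ ts.2,
        if γ.partition.parts = {ts.1, ts.2} then w ts * f {ts.1, ts.2} else 0 := by
    have hweight := sum_antidiagonal_pair_eq hγ γ.partition.parts_sum
      fun k hk => γ.partition.parts_pos hk
    rw [← Finset.sum_filter, Finset.filter_filter, Finset.sum_congr rfl fun ts hts => by
      rw [← (Finset.mem_filter.1 hts).2.2], ← Finset.sum_mul, hweight]
    ring
  have hclass (ts : ℕ × ℕ) (hts : ts ∈ (antidiagonal (Fintype.card α)).filter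
      fun ts => 1 ≤ ts.1 ∧ 1 ≤ ts.2) :
      (∑ γ : Perm α with cycleCount γ = 2,
        if γ.partition.parts = {ts.1, ts.2} then w ts * f {ts.1, ts.2} else 0) =
      (Fintype.card α).factorial * (f {ts.1, ts.2} / ((ts.1 : ℝ) * ts.2)) := by
    obtain ⟨hN, ht, hs⟩ := Finset.mem_filter.1 hts
    rw [← Finset.sum_filter, Finset.filter_filter, Finset.filter_congr fun γ _ =>
      and_iff_right_of_imp fun h : γ.partition.parts = {ts.1, ts.2} => by
        rw [cycleCount, h, Multiset.card_pair],
      Finset.sum_const, nsmul_eq_mul, ← mul_assoc,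
      card_partition_parts_eq_pair (HasAntidiagonal.mem_antidiagonal.1 hN) ht hs]
    ring
  rw [Finset.sum_congr rfl fun γ hγ => hsplit γ (Finset.mem_filter.1 hγ).2, ← Finset.mul_sum,
    Finset.sum_comm, Finset.sum_congr rfl hclass, ← Finset.mul_sum]
  ring

/-- The sum over pairs of positive `t + s = n` and annular non-crossing permutations that appears in
the infinitesimal moment formula. -/
def annularSum (u : ℕ → ℝ) (n : ℕ) : ℝ :=
  ∑ ts ∈ antidiagonal n with 1 ≤ ts.1 ∧ 1 ≤ ts.2,
    ∑ σ ∈ annularNC ts.1 ts.2, cycleProd u σ / ((ts.1 : ℝ) * (ts.2 : ℝ))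

theorem sum_relativeSum_annular (u : ℕ → ℝ) (n : ℕ) :
    ∑ γ : Perm (Fin (n + 1)), relativeSum u (n + 1) γ =
      ((n + 1).factorial : ℝ) / 2 * annularSum u (n + 1) := by
  have hcycles (γ : Perm (Fin (n + 1))) (hγ : relativeSum u (n + 1) γ ≠ 0) : cycleCount γ = 2 := by
    contrapose! hγ
    refine relativeSum_eq_zero u fun σ τ htrans hcount hmul => hγ ?_
    rw [← hmul]
    exact cycleCount_mul_eq_two htrans (by rw [hcount, Fintype.card_fin])
  have hfactor : (relativeSum u (n + 1) : Perm (Fin (n + 1)) → ℝ).FactorsThrough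
      fun γ => γ.partition.parts := fun _ _ h => relativeSum_congr u _ h
  obtain ⟨f, hf⟩ := (Function.factorsThrough_iff _).1 hfactor
  rw [← Finset.sum_filter_of_ne fun γ _ => hcycles γ, hf]
  simp only [Function.comp_apply, sum_cycleCount_eq_two f, Fintype.card_fin, annularSum,
    ← Finset.sum_div]
  congr 1
  refine Finset.sum_congr rfl fun ts hts => ?_
  obtain ⟨hN, ht, hs⟩ := Finset.mem_filter.1 hts
  rw [HasAntidiagonal.mem_antidiagonal] at hN
  rw [← partition_parts_annularRotation ht hs, ← partition_parts_permCongr (finCongr hN)]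
  rw [show f _ = _ from (congrFun hf _).symm, relativeSum_permCongr, ← hN,
    relativeSum_annularRotation]

end TwoCycles

/-! ### First-order asymptotics -/

section Expansions

/-- `f d = a + b / d + o(1 / d)` as `d → ∞`, encoded as the convergence `d (f d - a) → b`. -/
def HasExpansion (f : ℕ → ℝ) (a b : ℝ) : Prop :=
  Tendsto (fun d : ℕ => (d : ℝ) * (f d - a)) atTop (𝓝 b)

theorem isLittleO_iff_hasExpansion {f : ℕ → ℝ} {a b : ℝ} :
    (fun d : ℕ => f d - (a + 1 / (d : ℝ) * b)) =o[atTop] (fun d : ℕ => 1 / (d : ℝ)) ↔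
      HasExpansion f a b := by
  have hne : ∀ᶠ d : ℕ in atTop, (d : ℝ) ≠ 0 := by
    filter_upwards [eventually_ne_atTop 0] with d hd using Nat.cast_ne_zero.2 hd
  rw [isLittleO_iff_tendsto' (hne.mono fun d hd h => absurd h (one_div_ne_zero hd)),
    HasExpansion, ← tendsto_sub_nhds_zero_iff (x := b)]
  refine tendsto_congr' (hne.mono fun d hd => ?_)
  field_simp
  ring

variable {f g : ℕ → ℝ} {a b a' b' : ℝ}

namespace HasExpansion

theorem tendsto (h : HasExpansion f a b) : Tendsto f atTop (𝓝 a) := by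
  have hlim := (Tendsto.mul h tendsto_one_div_atTop_nhds_zero_nat).add_const a
  rw [mul_zero, zero_add] at hlim
  refine hlim.congr' ?_
  filter_upwards [eventually_ne_atTop 0] with d hd
  field_simp
  ring

theorem unique (h : HasExpansion f a b) (h' : HasExpansion f a' b') : a = a' ∧ b = b' := by
  obtain rfl := tendsto_nhds_unique h.tendsto h'.tendsto
  exact ⟨rfl, tendsto_nhds_unique h h'⟩

theorem congr' (h : HasExpansion f a b) (hfg : f =ᶠ[atTop] g) : HasExpansion g a b :=
  Tendsto.congr' (hfg.mono fun d hd => by rw [hd]) h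

theorem const (a : ℝ) : HasExpansion (fun _ => a) a 0 := by
  simp [HasExpansion]

theorem one_div_mul (h : Tendsto g atTop (𝓝 b)) :
    HasExpansion (fun d => 1 / (d : ℝ) * g d) 0 b := by
  refine h.congr' ?_
  filter_upwards [eventually_ne_atTop 0] with d hd
  field_simp
  ring

theorem add (h : HasExpansion f a b) (h' : HasExpansion g a' b') :
    HasExpansion (fun d => f d + g d) (a + a') (b + b') :=
  (Tendsto.add h h').congr fun d => by ring

theorem mul (h : HasExpansion f a b) (h' : HasExpansion g a' b') :
    HasExpansion (fun d => f d * g d) (a * a') (b * a' + a * b') :=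
  ((Tendsto.mul h h'.tendsto).add (Tendsto.const_mul a h')).congr fun d => by ring

theorem inv (h : HasExpansion f a b) (ha : a ≠ 0) :
    HasExpansion (fun d => (f d)⁻¹) a⁻¹ (-b / (a * a)) := by
  refine Tendsto.congr' ?_ ((Tendsto.neg h).div (h.tendsto.mul_const a) (mul_ne_zero ha ha))
  filter_upwards [h.tendsto.eventually_ne ha] with d hd
  simp only [Pi.div_apply]
  field_simp
  ring

variable {ι : Type*} {s : Finset ι} {F : ι → ℕ → ℝ} {A B : ι → ℝ}

theorem sum (h : ∀ i ∈ s, HasExpansion (F i) (A i) (B i)) :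
    HasExpansion (fun d => ∑ i ∈ s, F i d) (∑ i ∈ s, A i) (∑ i ∈ s, B i) := by
  refine (tendsto_finsetSum s h).congr fun d => ?_
  rw [← Finset.mul_sum, Finset.sum_sub_distrib]

theorem prod [DecidableEq ι] (h : ∀ i ∈ s, HasExpansion (F i) (A i) (B i)) :
    HasExpansion (fun d => ∏ i ∈ s, F i d) (∏ i ∈ s, A i)
      (∑ i ∈ s, B i * ∏ j ∈ s.erase i, A j) := by
  induction s using Finset.induction_on with
  | empty => exact const 1
  | insert x s hx ih =>
    have hproduct := (h x (mem_insert_self x s)).mul (ih fun i hi => h i (mem_insert_of_mem hi))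
    have hleibniz : ∑ i ∈ insert x s, B i * ∏ j ∈ (insert x s).erase i, A j =
        B x * ∏ j ∈ s, A j + A x * ∑ i ∈ s, B i * ∏ j ∈ s.erase i, A j := by
      rw [Finset.sum_insert hx, Finset.erase_insert hx, Finset.mul_sum]
      congr 1
      refine Finset.sum_congr rfl fun i hi => ?_
      rw [Finset.erase_insert_of_ne (ne_of_mem_of_not_mem hi hx).symm,
        Finset.prod_insert (notMem_mono (erase_subset i s) hx)]
      ring
    simpa only [Finset.prod_insert hx, hleibniz] using hproduct

end HasExpansion

/-- The algebra of the real sequences that have a first-order expansion in `1 / d`. -/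
def expandable : Subalgebra ℝ (ℕ → ℝ) where
  carrier := {f | ∃ a b, HasExpansion f a b}
  add_mem' := fun ⟨_, _, hf⟩ ⟨_, _, hg⟩ => ⟨_, _, hf.add hg⟩
  mul_mem' := fun ⟨_, _, hf⟩ ⟨_, _, hg⟩ => ⟨_, _, hf.mul hg⟩
  algebraMap_mem' c := ⟨c, 0, HasExpansion.const c⟩

theorem one_div_mem_expandable : (fun d : ℕ => 1 / (d : ℝ)) ∈ expandable :=
  ⟨0, 1, by simpa only [mul_one] using HasExpansion.one_div_mul (tendsto_const_nhds (x := 1))⟩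

theorem inv_mem_expandable (hf : f ∈ expandable) (hlim : Tendsto f atTop (𝓝 a)) (ha : a ≠ 0) :
    f⁻¹ ∈ expandable := by
  obtain ⟨a', b, hf⟩ := hf
  obtain rfl := tendsto_nhds_unique hf.tendsto hlim
  exact ⟨_, _, hf.inv ha⟩

theorem cycleWeight_mem_expandable {α : Type*} [Fintype α] [DecidableEq α] {κ : ℕ → ℕ → ℝ}
    (σ : Perm α) (h : ∀ V ∈ (cyclePartition σ).parts, (fun d => κ d V.card) ∈ expandable) :
    (fun d => cycleWeight (κ d) σ) ∈ expandable := by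
  simp only [cycleWeight_eq_prod]
  simpa only [← Finset.prod_fn] using prod_mem h

theorem tendsto_cycleWeight {α ι : Type*} [Fintype α] [DecidableEq α] {l : Filter ι}
    {κ : ι → ℕ → ℝ} {a : ℕ → ℝ} (h : ∀ j, 1 ≤ j → Tendsto (fun i => κ i j) l (𝓝 (a j)))
    (σ : Perm α) : Tendsto (fun i => cycleWeight (κ i) σ) l (𝓝 (cycleWeight a σ)) := by
  simp only [cycleWeight_eq_prod]
  exact tendsto_finsetProd _ fun V hV =>
    h _ (Finset.card_pos.2 ((cyclePartition σ).nonempty_of_mem_parts hV))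

end Expansions

section GenusExpansion

open Classical in
/-- The part of the genus expansion of order at least two in `ε`, divided by `ε²`. -/
def genusRemainder (n : ℕ) (u : ℕ → ℝ) (ε : ℝ) : ℝ :=
  1 / (n.factorial : ℝ) * ∑ p : Perm (Fin (n + 1)) × Perm (Fin (n + 1)) with
    JointlyTransitive p.1 p.2 ∧ cycleCount p.1 + cycleCount p.2 ≤ n,
      cycleWeight u p.1 * (-ε) ^ (n - (cycleCount p.1 + cycleCount p.2))

theorem neg_pow_sub_eq {R : Type*} [CommRing R] (ε : R) {n c : ℕ} (hc : c ≤ n + 2) :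
    (-ε) ^ (n + 2 - c) = (if c = n + 2 then 1 else 0) - ε * (if c = n + 1 then 1 else 0) +
      ε * (ε * if c ≤ n then (-ε) ^ (n - c) else 0) := by
  obtain rfl | rfl | hc : c = n + 2 ∨ c = n + 1 ∨ c ≤ n := by omega
  · simp
  · simp [show n + 2 - (n + 1) = 1 by omega]
  · rw [if_neg (by omega), if_neg (by omega), if_pos hc, show n + 2 - c = n - c + 2 by omega]
    ring

theorem genusExpansion_eq (n : ℕ) (u : ℕ → ℝ) (ε : ℝ) :
    genusExpansion n u ε = ∑ π ∈ NC (n + 1), blockProd u π +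
      ε * (ε * genusRemainder n u ε - ((n + 1 : ℕ) : ℝ) / 2 * annularSum u (n + 1)) := by
  classical
  have hspherical := sum_relativeSum_genus_zero u n
  have hannular := sum_relativeSum_annular u n
  rw [← sum_pairs_eq_sum_relativeSum] at hspherical hannular
  have hsplit (p : Perm (Fin (n + 1)) × Perm (Fin (n + 1))) (hp : JointlyTransitive p.1 p.2) :
      cycleWeight u p.1 * (-ε) ^ (n + 2 - (cycleCount p.1 + cycleCount p.2)) =
        (if cycleCount p.1 + cycleCount p.2 = n + 2 then cycleWeight u p.1 else 0) -
        ε * (if cycleCount p.1 + cycleCount p.2 = n + 1 then cycleWeight u p.1 else 0) +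
        ε * (ε * if cycleCount p.1 + cycleCount p.2 ≤ n then
          cycleWeight u p.1 * (-ε) ^ (n - (cycleCount p.1 + cycleCount p.2)) else 0) := by
    have hgenus := cycleCount_add_le hp
    rw [Fintype.card_fin] at hgenus
    rw [neg_pow_sub_eq ε hgenus]
    split_ifs <;> ring
  rw [genusExpansion, Finset.sum_congr rfl fun p hp => hsplit p (Finset.mem_filter.1 hp).2,
    Finset.sum_add_distrib, Finset.sum_sub_distrib, ← Finset.mul_sum, ← Finset.mul_sum,
    ← Finset.mul_sum, ← Finset.sum_filter, ← Finset.sum_filter, ← Finset.sum_filter,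
    Finset.filter_filter, Finset.filter_filter, Finset.filter_filter, hspherical, hannular,
    genusRemainder, Nat.factorial_succ, Nat.cast_mul]
  field_simp
  ring

section Limits

variable {ι : Type*} {l : Filter ι} {κ : ι → ℕ → ℝ} {a : ℕ → ℝ}

theorem tendsto_genusRemainder (h : ∀ j, 1 ≤ j → Tendsto (fun i => κ i j) l (𝓝 (a j)))
    {ε : ι → ℝ} {e : ℝ} (hε : Tendsto ε l (𝓝 e)) (n : ℕ) :
    Tendsto (fun i => genusRemainder n (κ i) (ε i)) l (𝓝 (genusRemainder n a e)) :=
  (tendsto_finsetSum _ fun p _ => (tendsto_cycleWeight h p.1).mul (hε.neg.pow _)).const_mul _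

theorem tendsto_annularSum (h : ∀ j, 1 ≤ j → Tendsto (fun i => κ i j) l (𝓝 (a j))) (n : ℕ) :
    Tendsto (fun i => annularSum (κ i) n) l (𝓝 (annularSum a n)) :=
  tendsto_finsetSum _ fun _ _ => tendsto_finsetSum _ fun σ _ =>
    (tendsto_cycleWeight h σ).div_const _

end Limits

/-- First-order expansion in `1 / d` of all terms of positive index of a sequence of sequences. -/
def HasExpansions (κ : ℕ → ℕ → ℝ) (a b : ℕ → ℝ) : Prop :=
  ∀ n, 1 ≤ n → HasExpansion (fun d => κ d n) (a n) (b n)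

theorem HasExpansions.hasExpansion_genusExpansion {κ : ℕ → ℕ → ℝ} {a b : ℕ → ℝ}
    (h : HasExpansions κ a b) (n : ℕ) :
    HasExpansion (fun d => genusExpansion n (κ d) (1 / (d : ℝ)))
      (∑ π ∈ NC (n + 1), blockProd a π) (infinitesimalMomentFormula a b (n + 1)) := by
  have hlim (j : ℕ) (hj : 1 ≤ j) := (h j hj).tendsto
  have hε := tendsto_one_div_atTop_nhds_zero_nat (𝕜 := ℝ)
  have hspherical : HasExpansion (fun d => ∑ π ∈ NC (n + 1), blockProd (κ d) π)
      (∑ π ∈ NC (n + 1), blockProd a π)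
      (∑ π ∈ NC (n + 1), ∑ V ∈ π.parts, (b V.card * ∏ W ∈ π.parts.erase V, a W.card)) :=
    HasExpansion.sum fun π _ => HasExpansion.prod fun V hV =>
      h _ (Finset.card_pos.2 (π.nonempty_of_mem_parts hV))
  have hcorrection := (hε.mul (tendsto_genusRemainder hlim hε n)).sub
    ((tendsto_annularSum hlim (n + 1)).const_mul (((n + 1 : ℕ) : ℝ) / 2))
  rw [zero_mul, zero_sub] at hcorrection
  simp only [genusExpansion_eq]
  simpa only [add_zero, infinitesimalMomentFormula, annularSum, ← sub_eq_add_neg] using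
    hspherical.add (HasExpansion.one_div_mul hcorrection)

theorem parts_top_eq (n : ℕ) : (⊤ : SetPartition (n + 1)).parts = {univ} :=
  (Finset.Nonempty.subset_singleton_iff
    (Finpartition.parts_nonempty _ (Finset.ne_empty_of_mem (mem_univ 0)))).1
    (Finpartition.parts_top_subset _)

open Classical in
/-- The part of the genus expansion that only involves `u_1, …, u_n`. -/
def genusLower (n : ℕ) (u : ℕ → ℝ) (ε : ℝ) : ℝ :=
  1 / (n.factorial : ℝ) * ∑ p : Perm (Fin (n + 1)) × Perm (Fin (n + 1)) with
    JointlyTransitive p.1 p.2 ∧ cycleCount p.1 ≠ 1,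
      cycleWeight u p.1 * (-ε) ^ (n + 2 - (cycleCount p.1 + cycleCount p.2))

/-- The coefficient of `u_{n+1}` in the genus expansion. -/
def genusTop (n : ℕ) (ε : ℝ) : ℝ :=
  ∑ τ : Perm (Fin (n + 1)), (-ε) ^ (n + 1 - cycleCount τ)

open Classical in
theorem sum_pairs_cycleCount_eq_one (n : ℕ) (u : ℕ → ℝ) (ε : ℝ) :
    ∑ p : Perm (Fin (n + 1)) × Perm (Fin (n + 1)) with
      JointlyTransitive p.1 p.2 ∧ cycleCount p.1 = 1,
      cycleWeight u p.1 * (-ε) ^ (n + 2 - (cycleCount p.1 + cycleCount p.2)) =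
      n.factorial * (u (n + 1) * genusTop n ε) := by
  have hpairs : (univ.filter fun p : Perm (Fin (n + 1)) × Perm (Fin (n + 1)) =>
      JointlyTransitive p.1 p.2 ∧ cycleCount p.1 = 1) =
      (univ.filter fun σ : Perm (Fin (n + 1)) => cycleCount σ = 1) ×ˢ univ := by
    ext p
    simp only [mem_filter_univ, mem_product, mem_univ, and_true]
    exact and_iff_right_of_imp (jointlyTransitive_of_cycleCount_eq_one p.2)
  rw [hpairs, Finset.sum_product, ← card_cycleCount_eq_one, ← nsmul_eq_mul]
  refine Finset.sum_eq_card_nsmul fun σ hσ => ?_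
  have hσ := (Finset.mem_filter.1 hσ).2
  rw [genusTop, Finset.mul_sum]
  refine Finset.sum_congr rfl fun τ _ => ?_
  rw [cycleWeight_of_cycleCount_eq_one u hσ, hσ, Fintype.card_fin,
    show n + 2 - (1 + cycleCount τ) = n + 1 - cycleCount τ by omega]

theorem genusExpansion_eq_top_add_lower (n : ℕ) (u : ℕ → ℝ) (ε : ℝ) :
    genusExpansion n u ε = u (n + 1) * genusTop n ε + genusLower n u ε := by
  classical
  rw [genusExpansion, ← Finset.sum_filter_add_sum_filter_not _ fun p => cycleCount p.1 = 1,
    Finset.filter_filter, Finset.filter_filter, sum_pairs_cycleCount_eq_one, mul_add,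
    one_div, inv_mul_cancel_left₀ (by positivity)]
  simp only [genusLower, one_div]

theorem genusTop_zero (n : ℕ) : genusTop n 0 = 1 := by
  rw [genusTop, Finset.sum_eq_single 1]
  · rw [cycleCount_one, Fintype.card_fin, Nat.sub_self, pow_zero]
  · intro τ _ hτ
    have hne := mt cycleCount_eq_card_iff.1 hτ
    have hle := cycleCount_le τ
    rw [Fintype.card_fin] at hne hle
    rw [neg_zero, zero_pow (by omega)]
  · exact fun h => absurd (mem_univ _) h

theorem tendsto_genusTop (n : ℕ) :
    Tendsto (fun d : ℕ => genusTop n (1 / (d : ℝ))) atTop (𝓝 1) := by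
  have hcont : Continuous (genusTop n) := by
    unfold genusTop
    fun_prop
  have hlim := (hcont.tendsto 0).comp (tendsto_one_div_atTop_nhds_zero_nat (𝕜 := ℝ))
  rwa [genusTop_zero] at hlim

theorem neg_one_div_pow_mem_expandable (k : ℕ) :
    (fun d : ℕ => (-(1 / (d : ℝ))) ^ k) ∈ expandable :=
  pow_mem (neg_mem one_div_mem_expandable) k

theorem genusTop_mem_expandable (n : ℕ) :
    (fun d : ℕ => genusTop n (1 / (d : ℝ))) ∈ expandable := by
  simp only [genusTop]
  simpa only [← Finset.sum_fn] using sum_mem fun τ _ => neg_one_div_pow_mem_expandable _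

theorem card_le_of_mem_parts_cyclePartition {n : ℕ} {σ : Perm (Fin (n + 1))}
    (hσ : cycleCount σ ≠ 1) {V : Finset (Fin (n + 1))} (hV : V ∈ (cyclePartition σ).parts) :
    V.card ≤ n := by
  refine Nat.lt_succ_iff.1 (card_lt_of_ne_top (fun htop => hσ ?_) hV)
  rw [cycleCount_eq_card_parts, htop, parts_top_eq, Finset.card_singleton]

theorem genusLower_mem_expandable {n : ℕ} {κ : ℕ → ℕ → ℝ}
    (h : ∀ j, 1 ≤ j → j ≤ n → (fun d => κ d j) ∈ expandable) :
    (fun d => genusLower n (κ d) (1 / (d : ℝ))) ∈ expandable := by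
  classical
  have hweight (σ : Perm (Fin (n + 1))) (hσ : cycleCount σ ≠ 1) :
      (fun d => cycleWeight (κ d) σ) ∈ expandable :=
    cycleWeight_mem_expandable σ fun V hV =>
      h _ (Finset.card_pos.2 ((cyclePartition σ).nonempty_of_mem_parts hV))
        (card_le_of_mem_parts_cyclePartition hσ hV)
  have hsum := sum_mem fun p (hp : p ∈ univ.filter
      fun p : Perm (Fin (n + 1)) × Perm (Fin (n + 1)) =>
        JointlyTransitive p.1 p.2 ∧ cycleCount p.1 ≠ 1) =>
    mul_mem (hweight p.1 (Finset.mem_filter.1 hp).2.2)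
      (neg_one_div_pow_mem_expandable (n + 2 - (cycleCount p.1 + cycleCount p.2)))
  convert expandable.smul_mem hsum (1 / (n.factorial : ℝ)) using 1
  ext d
  simp only [genusLower, Pi.smul_apply, Finset.sum_apply, Pi.mul_apply, smul_eq_mul]

end GenusExpansion

/-! ### Inverting the moment-cumulant relations -/

section Inversion

theorem eq_of_sum_NC_blockProd_eq {u v : ℕ → ℝ}
    (h : ∀ n, 1 ≤ n → ∑ π ∈ NC n, blockProd u π = ∑ π ∈ NC n, blockProd v π)
    (n : ℕ) (hn : 1 ≤ n) : u n = v n := by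
  induction n using Nat.strong_induction_on with
  | _ n ih =>
    obtain ⟨n, rfl⟩ := Nat.exists_eq_add_one.2 hn
    have htop (w : ℕ → ℝ) : blockProd w (⊤ : SetPartition (n + 1)) = w (n + 1) := by
      simp [blockProd, parts_top_eq]
    have hrest : ∑ π ∈ (NC (n + 1)).erase ⊤, blockProd u π =
        ∑ π ∈ (NC (n + 1)).erase ⊤, blockProd v π :=
      Finset.sum_congr rfl fun π hπ => Finset.prod_congr rfl fun V hV =>
        ih _ (card_lt_of_ne_top (Finset.ne_of_mem_erase hπ) hV)
          (Finset.card_pos.2 (π.nonempty_of_mem_parts hV))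
    have hsum := h (n + 1) hn
    rw [← Finset.add_sum_erase _ _ top_mem_NC, ← Finset.add_sum_erase _ _ top_mem_NC, htop, htop,
      hrest] at hsum
    exact add_right_cancel hsum

theorem eq_freeCumulantSeq {m u : ℕ → ℝ}
    (h : ∀ n, 1 ≤ n → ∑ π ∈ NC n, blockProd u π = m n) (n : ℕ) (hn : 1 ≤ n) :
    u n = freeCumulantSeq m n :=
  eq_of_sum_NC_blockProd_eq (fun k hk => (h k hk).trans (moment_eq_sum_blockProd m hk)) n hn

theorem eq_of_infinitesimalMomentFormula_eq {r u v : ℕ → ℝ}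
    (h : ∀ n, 1 ≤ n → infinitesimalMomentFormula r u n = infinitesimalMomentFormula r v n)
    (n : ℕ) (hn : 1 ≤ n) : u n = v n := by
  induction n using Nat.strong_induction_on with
  | _ n ih =>
    obtain ⟨n, rfl⟩ := Nat.exists_eq_add_one.2 hn
    have hrest : ∑ π ∈ (NC (n + 1)).erase ⊤,
        ∑ V ∈ π.parts, (u V.card * ∏ W ∈ π.parts.erase V, r W.card) =
        ∑ π ∈ (NC (n + 1)).erase ⊤,
          ∑ V ∈ π.parts, (v V.card * ∏ W ∈ π.parts.erase V, r W.card) :=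
      Finset.sum_congr rfl fun π hπ => Finset.sum_congr rfl fun V hV => by
        rw [ih V.card (card_lt_of_ne_top (Finset.ne_of_mem_erase hπ) hV)
          (Finset.card_pos.2 (π.nonempty_of_mem_parts hV))]
    have hformula := h (n + 1) hn
    rw [infinitesimalMomentFormula, infinitesimalMomentFormula, sub_left_inj,
      ← Finset.add_sum_erase _ _ top_mem_NC, ← Finset.add_sum_erase _ _ top_mem_NC, hrest,
      add_left_inj, parts_top_eq] at hformula
    simpa using hformula

end Inversion

section Transfer

theorem HasExpansions.iff_forall_eq {κ : ℕ → ℕ → ℝ} {a b b' : ℕ → ℝ} (h : HasExpansions κ a b) :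
    HasExpansions κ a b' ↔ ∀ n, 1 ≤ n → b' n = b n :=
  ⟨fun h' n hn => ((h' n hn).unique (h n hn)).2, fun heq n hn => heq n hn ▸ h n hn⟩

variable {m κ : ℕ → ℕ → ℝ} {M m' rhat : ℕ → ℝ}

theorem HasExpansions.moments_of_cumulants
    (hmκ : ∀ n, (fun d => m d (n + 1)) =ᶠ[atTop] fun d => genusExpansion n (κ d) (1 / (d : ℝ)))
    (h : HasExpansions κ (freeCumulantSeq M) rhat) :
    HasExpansions m M (infinitesimalMomentFormula (freeCumulantSeq M) rhat) := by
  intro n hn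
  obtain ⟨n, rfl⟩ := Nat.exists_eq_add_one.2 hn
  rw [moment_eq_sum_blockProd M hn]
  exact (h.hasExpansion_genusExpansion n).congr' (hmκ n).symm

theorem cumulant_mem_expandable
    (hmκ : ∀ n, (fun d => m d (n + 1)) =ᶠ[atTop] fun d => genusExpansion n (κ d) (1 / (d : ℝ)))
    (hm : ∀ n, 1 ≤ n → (fun d => m d n) ∈ expandable) (n : ℕ) (hn : 1 ≤ n) :
    (fun d => κ d n) ∈ expandable := by
  induction n using Nat.strong_induction_on with
  | _ n ih =>
    obtain ⟨n, rfl⟩ := Nat.exists_eq_add_one.2 hn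
    have hlower := genusLower_mem_expandable fun j hj hjn => ih j (Nat.lt_succ_of_le hjn) hj
    have htop := inv_mem_expandable (genusTop_mem_expandable n) (tendsto_genusTop n) one_ne_zero
    obtain ⟨a, b, hquotient⟩ := mul_mem (sub_mem (hm (n + 1) hn) hlower) htop
    refine ⟨a, b, hquotient.congr' ?_⟩
    filter_upwards [hmκ n, (tendsto_genusTop n).eventually_ne one_ne_zero] with d hd hne
    simp only [Pi.mul_apply, Pi.sub_apply, Pi.inv_apply]
    rw [hd, genusExpansion_eq_top_add_lower, add_sub_cancel_right, mul_inv_cancel_right₀ hne]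

theorem HasExpansions.exists_cumulants
    (hmκ : ∀ n, (fun d => m d (n + 1)) =ᶠ[atTop] fun d => genusExpansion n (κ d) (1 / (d : ℝ)))
    (h : HasExpansions m M m') : ∃ rhat, HasExpansions κ (freeCumulantSeq M) rhat := by
  have hmem := cumulant_mem_expandable hmκ fun n hn => ⟨_, _, h n hn⟩
  choose! a rhat hκ using hmem
  refine ⟨rhat, fun n hn => ?_⟩
  have hleading (k : ℕ) (hk : 1 ≤ k) : ∑ π ∈ NC k, blockProd a π = M k := by
    obtain ⟨k, rfl⟩ := Nat.exists_eq_add_one.2 hk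
    have hexpand := HasExpansions.hasExpansion_genusExpansion hκ k
    exact (hexpand.unique ((h (k + 1) hk).congr' (hmκ k))).1
  rw [← eq_freeCumulantSeq hleading n hn]
  exact hκ n hn

end Transfer

section Polynomials

variable {p : ℕ → Polynomial ℝ} {μ : Measure ℝ}

theorem hasInfinitesimalMoments_iff {m' : ℕ → ℝ} :
    HasInfinitesimalMoments p μ m' ↔ HasExpansions (fun d => rootMoment (p d)) (moment μ) m' :=
  forall₂_congr fun _ _ => isLittleO_iff_hasExpansion

theorem hasCumulantFluctuations_iff {rhat : ℕ → ℝ} :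
    HasCumulantFluctuations p μ rhat ↔
      HasExpansions (fun d => finiteFreeCumulant (p d)) (freeCumulantSeq (moment μ)) rhat :=
  forall₂_congr fun _ _ => isLittleO_iff_hasExpansion

theorem rootMoment_eventuallyEq_genusExpansion
    (hp : ∀ᶠ d in atTop, IsMonicRealRooted d (p d)) (n : ℕ) :
    (fun d => rootMoment (p d) (n + 1)) =ᶠ[atTop]
      fun d => genusExpansion n (finiteFreeCumulant (p d)) (1 / (d : ℝ)) := by
  filter_upwards [hp, eventually_ge_atTop 1] with d hd hpos
  exact rootMoment_eq_genusExpansion hpos hd n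

end Polynomials

end

end FiniteFree

open FiniteFree in
theorem mainTheorem4_general (p : ℕ → Polynomial ℝ)
    (hp : ∀ᶠ d in atTop, IsMonicRealRooted d (p d)) (M : ℕ → ℝ) :
    ((∃ m', HasExpansions (fun d => rootMoment (p d)) M m') ↔
      ∃ rhat, HasExpansions (fun d => finiteFreeCumulant (p d)) (freeCumulantSeq M) rhat) ∧
    (∀ m' rhat : ℕ → ℝ, HasExpansions (fun d => rootMoment (p d)) M m' →
      HasExpansions (fun d => finiteFreeCumulant (p d)) (freeCumulantSeq M) rhat →
      ∀ n, 1 ≤ n → m' n = infinitesimalMomentFormula (freeCumulantSeq M) rhat n) ∧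
    (∀ m' rhat : ℕ → ℝ,
      (∀ n, 1 ≤ n → m' n = infinitesimalMomentFormula (freeCumulantSeq M) rhat n) →
      (HasExpansions (fun d => rootMoment (p d)) M m' ↔
        HasExpansions (fun d => finiteFreeCumulant (p d)) (freeCumulantSeq M) rhat)) := by
  have hmκ := rootMoment_eventuallyEq_genusExpansion hp
  refine ⟨⟨fun ⟨_, hm⟩ => hm.exists_cumulants hmκ,
      fun ⟨_, hκ⟩ => ⟨_, hκ.moments_of_cumulants hmκ⟩⟩,
    fun _ _ hm hκ => (hκ.moments_of_cumulants hmκ).iff_forall_eq.1 hm,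
    fun m' rhat hformula => ⟨fun hm => ?_, fun hκ =>
      (hκ.moments_of_cumulants hmκ).iff_forall_eq.2 hformula⟩⟩
  obtain ⟨rhat₀, hκ₀⟩ := hm.exists_cumulants hmκ
  have hformula₀ := (hκ₀.moments_of_cumulants hmκ).iff_forall_eq.1 hm
  exact hκ₀.iff_forall_eq.2 <| eq_of_infinitesimalMomentFormula_eq fun n hn =>
    (hformula n hn).symm.trans (hformula₀ n hn)

theorem mainTheorem4 (p : ℕ → Polynomial ℝ)
    (hp : ∀ d : ℕ, 1 ≤ d → FiniteFree.IsMonicRealRooted d (p d))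
    (μ : MeasureTheory.Measure ℝ) [MeasureTheory.IsProbabilityMeasure μ]
    (hμ : FiniteFree.HasLimitingDistribution p μ) :
    ((∃ m' : ℕ → ℝ, FiniteFree.HasInfinitesimalMoments p μ m') ↔
      (∃ rhat : ℕ → ℝ, FiniteFree.HasCumulantFluctuations p μ rhat)) ∧
    (∀ m' rhat : ℕ → ℝ,
      FiniteFree.HasInfinitesimalMoments p μ m' →
      FiniteFree.HasCumulantFluctuations p μ rhat →
      ∀ n : ℕ, 1 ≤ n →
        m' n = FiniteFree.infinitesimalMomentFormula (FiniteFree.freeCumulant μ) rhat n) ∧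
    (∀ m' rhat : ℕ → ℝ,
      (∀ n : ℕ, 1 ≤ n →
        m' n = FiniteFree.infinitesimalMomentFormula (FiniteFree.freeCumulant μ) rhat n) →
      (FiniteFree.HasInfinitesimalMoments p μ m' ↔
        FiniteFree.HasCumulantFluctuations p μ rhat)) := by
  simp only [FiniteFree.hasInfinitesimalMoments_iff, FiniteFree.hasCumulantFluctuations_iff]
  exact mainTheorem4_general p (eventually_atTop.2 ⟨1, hp⟩) (FiniteFree.moment μ)
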